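/- **Conventions.** Let $Q$ be a real binary quadratic form that is indefinite (it takes positive and negative values on $\mathbb R^2$) and satisfies $Q(z)\ne 0$ for all $z\in\mathbb Z^2\setminus\{0\}$, so that the zero set of $Q$ is a pair of lines whose only integer point is the origin $O$. *Sail and LLS sequence.* Let $C$ be one of the four open angles formed by these lines. The *Arnold sail* of $C$ is the boundary of the convex hull of the integer points in $C$. It is a broken line with vertices $(A_k)_{k\in\mathbb Z}$, numbered in order along the sail. For distinct integer points, the integer length $\mathrm{l}\ell(AB)$ is the number of integer points in the interior of the segment $AB$ plus one, and $\mathrm{l}\sin\angle ABC=\mathrm{l}S(ABC)/(\mathrm{l}\ell(AB)\,\mathrm{l}\ell(BC))$, where $\mathrm{l}S(ABC)$ is the index in $\mathbb Z^2$ of the subgroup generated by the vectors $AB$ and $BC$. The *LLS sequence* $(a_i)_{i\in\mathbb Z}$ of $C$ is given by $a_{2k}=\mathrm{l}\ell(A_kA_{k+1})$, $a_{2k-1}=\mathrm{l}\sin\angle A_{k-1}A_kA_{k+1}$; it depends on the numbering of the vertices. *Topograph and river.* A lax vector is a pair $\pm v$, $v\in\mathbb Z^2$. A superbase is a set $\{\pm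 e_1,\pm e_2,\pm e_3\}$ where $(e_1,e_2)$ is a basis of $\mathbb Z^2$ and $e_1+e_2+e_3=0$. The superbases are the vertices of a planar trivalent tree, two distinct superbases being adjacent when they have a common basis; the regions of the complement of the tree correspond to the primitive lax vectors, the regions on the two sides of an edge being the two lax vectors common to its ends. The topograph of $Q$ is this tree with the value $Q(v)$ attached to the region $\pm v$. The *Conway river* of $Q$ is the doubly infinite path made of exactly those edges that separate a positive from a negative value. The tree is embedded so that the edge directed from $\{\pm u,\pm v,\pm(u-v)\}$ to $\{\pm u,\pm v,\pm(u+v)\}$ with $\det(u,v)=1$ has $\pm u$ on its left and $\pm v$ on its right; a path turns left (right) at a vertex if it keeps the same region on its left (right). A sequence $(a_i)_{i\in\mathbb Z}$ of positive integers *coincides with the sequence of turns* of a directed doubly infinite path if its turns are, consecutively, $\dots$, $a_0$ turns to one side, $a_1$ turns to the other side, $a_2$ turns to the first side, $\dots$ The group $PGL(2,\mathbb Z)$ acts on the tree by $g\{\pm e_1,\pm e_2,\pm e_3\}=\{\pm ge_1,\pm ge_2,\pm ge_3\}$. **Theorem.** Let $Q$ be as above. Then the river of $Q$ exists, and for each of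 the four angles $C$ formed by the lines $Q=0$: 1. an LLS sequence $(a_i)$ of $C$ exists, and every LLS sequence of $C$ consists of positive integers and coincides with the sequence of left and right turns of the Conway river of $Q$, traversed in one of its two directions; 2. this sequence determines the river uniquely up to the action of $PGL(2,\mathbb Z)$ and a change of direction: a doubly infinite path on the tree has, in one of its two directions, the sequence of turns $(a_i)$ if and only if it is the image of the river of $Q$ under an element of $PGL(2,\mathbb Z)$, up to a change of direction. In particular, if $Q'$ is another such form, and an LLS sequence of one of its angles equals $(a_i)$ up to a shift of the indices and a reversal of their order, then the river of $Q'$ is the image of the river of $Q$ under an element of $PGL(2,\mathbb Z)$, up to a change of direction. -/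

import Mathlib

open scoped MatrixGroups Matrix

namespace ConwaySail

/-! ## The plane, the integer lattice and the Arnold sail -/

/-- The real plane. -/
abbrev Plane : Type := Fin 2 → ℝ

/-- The integer lattice. -/
abbrev IntPoint : Type := Fin 2 → ℤ

/-- The inclusion of the integer lattice in the plane. -/
def toPlane (z : IntPoint) : Plane := fun i => (z i : ℝ)

/-- The determinant of two integer vectors. -/
def latDet (u v : IntPoint) : ℤ := u 0 * v 1 - u 1 * v 0

/-- The integer length of the segment `AB` (for distinct integer points `A`, `B`):
the number of integer points in the interior of the segment, plus one. -/
noncomputable def integerLength (A B : IntPoint) : ℕ :=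
  {P : IntPoint | toPlane P ∈ openSegment ℝ (toPlane A) (toPlane B)}.ncard + 1

/-- The integer area of the triangle `ABC`: the index in the integer lattice of the sublattice
generated by the vectors `AB` and `BC`. -/
noncomputable def integerArea (A B C : IntPoint) : ℕ :=
  (AddSubgroup.closure ({B - A, C - B} : Set IntPoint)).index

/-- The integer sine of the angle `ABC`. -/
noncomputable def integerSine (A B C : IntPoint) : ℚ :=
  (integerArea A B C : ℚ) / ((integerLength A B : ℚ) * (integerLength B C : ℚ))

/-- `C` is (the interior of) one of the four angles formed by the pair of lines `Q = 0`: the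
points `p` and `q` lie on different lines of the pair, and `C` is the angle between the rays
`Op` and `Oq`. -/
def IsAngle (Q : QuadraticForm ℝ Plane) (C : Set Plane) : Prop :=
  ∃ p q : Plane, Q p = 0 ∧ Q q = 0 ∧ LinearIndependent ℝ ![p, q] ∧
    C = {w | ∃ s t : ℝ, 0 < s ∧ 0 < t ∧ w = s • p + t • q}

/-- The convex hull of the integer points inside the angle `C`. -/
def integerHull (C : Set Plane) : Set Plane :=
  convexHull ℝ (C ∩ Set.range toPlane)

/-- The Arnold sail of the angle `C`: the boundary of the convex hull of the integer points
inside `C`. -/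
def sail (C : Set Plane) : Set Plane := frontier (integerHull C)

/-- `A` lists the vertices of the sail of the angle `C` in the order in which they follow one
another along the sail (in one of its two directions): the `A k` are the vertices, without
repetition, and the sail is the broken line made of the segments from `A k` to `A (k + 1)`. -/
structure IsVertexSequence (C : Set Plane) (A : ℤ → IntPoint) : Prop where
  injective : Function.Injective A
  range_eq : Set.range (fun k => toPlane (A k)) = (integerHull C).extremePoints ℝ
  sail_eq : sail C = ⋃ k : ℤ, segment ℝ (toPlane (A k)) (toPlane (A (k + 1)))

/-- `a` is an LLS (lattice length sine) sequence of the angle `C`, for some numbering of the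
vertices of its sail. -/
def IsLLS (C : Set Plane) (a : ℤ → ℕ) : Prop :=
  ∃ A : ℤ → IntPoint, IsVertexSequence C A ∧
    (∀ k : ℤ, a (2 * k) = integerLength (A k) (A (k + 1))) ∧
    (∀ k : ℤ, (a (2 * k - 1) : ℚ) = integerSine (A (k - 1)) (A k) (A (k + 1)))

/-- Two sequences agree up to a shift of the indices and a change of orientation. -/
def SeqEquiv (a a' : ℤ → ℕ) : Prop :=
  ∃ k : ℤ, (∀ i, a' i = a (i + k)) ∨ (∀ i, a' i = a (k - i))

/-! ## The superbase tree and the topograph -/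

/-- The relation identifying `v` and `-v`. -/
def laxSetoid : Setoid IntPoint where
  r u v := u = v ∨ u = -v
  iseqv :=
    { refl := fun _ => Or.inl rfl
      symm := by
        rintro u v (h | h)
        · exact Or.inl h.symm
        · exact Or.inr (by rw [h, neg_neg])
      trans := by
        rintro u v w (rfl | rfl) (rfl | rfl)
        · exact Or.inl rfl
        · exact Or.inr rfl
        · exact Or.inr rfl
        · exact Or.inl (neg_neg _) }

/-- Lax vectors: integer vectors up to sign. -/
def LaxVector : Type := Quotient laxSetoid

/-- The lax vector `±v`. -/
def lax (v : IntPoint) : LaxVector := Quotient.mk laxSetoid v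

theorem lax_neg (v : IntPoint) : lax (-v) = lax v :=
  Quotient.sound (s := laxSetoid) (Or.inr rfl)

/-- The value of a quadratic form at a lax vector. -/
noncomputable def laxValue (Q : QuadraticForm ℝ Plane) : LaxVector → ℝ :=
  Quotient.lift (fun v => Q (toPlane v)) (by
    rintro u v (rfl | rfl)
    · rfl
    · have h : toPlane (-v) = -toPlane v := by
        funext i
        simp [toPlane]
      simp only [h, QuadraticMap.map_neg])

/-- `(u, v)` is a basis of the integer lattice. -/
def IsLatticeBasis (u v : IntPoint) : Prop :=
  ∃ b : Module.Basis (Fin 2) ℤ IntPoint, b 0 = u ∧ b 1 = v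

/-- `S` is a superbase: `S = {±e₁, ±e₂, ±e₃}`, where `(e₁, e₂)` is a basis of the lattice and
`e₁ + e₂ + e₃ = 0`. -/
def IsSuperbase (S : Set LaxVector) : Prop :=
  ∃ e₁ e₂ e₃ : IntPoint, IsLatticeBasis e₁ e₂ ∧ e₁ + e₂ + e₃ = 0 ∧
    S = {lax e₁, lax e₂, lax e₃}

/-- The vertices of the tree. -/
def Superbase : Type := {S : Set LaxVector // IsSuperbase S}

/-- The superbase tree underlying every topograph: two distinct superbases are joined by an edge
if they contain a common basis. The components of the complement of the planar tree correspond
to the primitive lax vectors, and the two lax vectors common to `S` and `T` are the regions on the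
two sides of the edge `ST`. The topograph of `Q` is this tree, each region `ℓ` carrying the value
`laxValue Q ℓ`. -/
def topograph : SimpleGraph Superbase where
  Adj S T := S ≠ T ∧ ∃ u v : IntPoint, IsLatticeBasis u v ∧
    lax u ∈ S.1 ∧ lax v ∈ S.1 ∧ lax u ∈ T.1 ∧ lax v ∈ T.1
  symm := ⟨by
    rintro S T ⟨hne, u, v, hb, h1, h2, h3, h4⟩
    exact ⟨hne.symm, u, v, hb, h3, h4, h1, h2⟩⟩
  loopless := ⟨fun _ h => h.1 rfl⟩

/-- A directed path on the tree, infinite in both directions. -/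
def IsPath (p : ℤ → Superbase) : Prop :=
  (∀ n, topograph.Adj (p n) (p (n + 1))) ∧ Function.Injective p

/-- The edge `ST` of the tree separates a positive and a negative value of `Q`. -/
def Separates (Q : QuadraticForm ℝ Plane) (S T : Superbase) : Prop :=
  ∃ ℓ m : LaxVector, ℓ ∈ S.1 ∧ ℓ ∈ T.1 ∧ m ∈ S.1 ∧ m ∈ T.1 ∧
    0 < laxValue Q ℓ ∧ laxValue Q m < 0

/-- `r` is the Conway river of `Q`, traversed in one of its two directions: a path made of exactly
those edges of the topograph that separate positive and negative values of `Q`. -/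
def IsRiver (Q : QuadraticForm ℝ Plane) (r : ℤ → Superbase) : Prop :=
  IsPath r ∧ ∀ S T : Superbase, topograph.Adj S T →
    (Separates Q S T ↔ ∃ n : ℤ, (r n = S ∧ r (n + 1) = T) ∨ (r n = T ∧ r (n + 1) = S))

/-- The path that goes from `S` to `T` and then to `U` turns left at `T`.
In the standard planar embedding of the tree (dual to the Farey tessellation of the hyperbolic
plane, where the region `±(x, y)` touches the boundary point `x / y`), a directed edge with the
region `±u` on its left and `±v` on its right goes from `{±u, ±v, ±(u - v)}` to
`{±u, ±v, ±(u + v)}`, where the signs are chosen so that `det (u, v) = 1`. After a left turn the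
region on the left is still `±u`, and the region on the right is `±(u + v)`. -/
def LeftTurn (S T U : Superbase) : Prop :=
  ∃ u v : IntPoint, latDet u v = 1 ∧
    S.1 = {lax u, lax v, lax (u - v)} ∧
    T.1 = {lax u, lax v, lax (u + v)} ∧
    U.1 = {lax u, lax (u + v), lax (u + (u + v))}

/-- The path that goes from `S` to `T` and then to `U` turns right at `T`: the region `±v` on the
right is kept, and the region on the left becomes `±(u + v)`. -/
def RightTurn (S T U : Superbase) : Prop :=
  ∃ u v : IntPoint, latDet u v = 1 ∧
    S.1 = {lax u, lax v, lax (u - v)} ∧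
    T.1 = {lax u, lax v, lax (u + v)} ∧
    U.1 = {lax v, lax (u + v), lax ((u + v) + v)}

/-- The sequence of left and right turns of the directed path `p` is
`…, a 0` turns to one side, `a 1` turns to the other side, `a 2` turns to the first side, `…`
with all `a i` positive. The vertices at which the turns of the `i`-th block take place are
`p j` with `c i ≤ j < c (i + 1)`. -/
def TurnsCoincide (p : ℤ → Superbase) (a : ℤ → ℕ) : Prop :=
  (∀ i, 0 < a i) ∧ ∃ c : ℤ → ℤ, (∀ i, c (i + 1) = c i + a i) ∧
    ((∀ i j, c i ≤ j → j < c (i + 1) →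
        (Even i → LeftTurn (p (j - 1)) (p j) (p (j + 1))) ∧
        (Odd i → RightTurn (p (j - 1)) (p j) (p (j + 1)))) ∨
     (∀ i j, c i ≤ j → j < c (i + 1) →
        (Even i → RightTurn (p (j - 1)) (p j) (p (j + 1))) ∧
        (Odd i → LeftTurn (p (j - 1)) (p j) (p (j + 1)))))

/-- The path `p` traversed in the opposite direction. -/
def reversePath (p : ℤ → Superbase) : ℤ → Superbase := fun n => p (-n)

/-! ## The action of `PGL(2, ℤ)` on the tree -/

theorem IsLatticeBasis.mulVec {u v : IntPoint} (h : IsLatticeBasis u v) (g : GL (Fin 2) ℤ) :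
    IsLatticeBasis (g.val *ᵥ u) (g.val *ᵥ v) := by
  obtain ⟨b, rfl, rfl⟩ := h
  refine ⟨b.map (Matrix.toLin'OfInv (M := (g⁻¹).val) (M' := g.val) ?_ ?_), ?_, ?_⟩
  · rw [← Units.val_mul, inv_mul_cancel, Units.val_one]
  · rw [← Units.val_mul, mul_inv_cancel, Units.val_one]
  · simp [Matrix.toLin'OfInv]
  · simp [Matrix.toLin'OfInv]

/-- The action of an integer matrix on lax vectors. -/
def laxMap (M : Matrix (Fin 2) (Fin 2) ℤ) : LaxVector → LaxVector :=
  Quotient.map' (s₁ := laxSetoid) (s₂ := laxSetoid) (fun v => M *ᵥ v) (by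
    rintro u v (rfl | rfl)
    · exact Or.inl rfl
    · exact Or.inr (Matrix.mulVec_neg _ _))

theorem laxMap_lax (M : Matrix (Fin 2) (Fin 2) ℤ) (v : IntPoint) :
    laxMap M (lax v) = lax (M *ᵥ v) := rfl

theorem laxMap_one (ℓ : LaxVector) : laxMap 1 ℓ = ℓ := by
  induction ℓ using Quotient.inductionOn with
  | h v => exact congrArg lax (Matrix.one_mulVec v)

theorem laxMap_mul (M N : Matrix (Fin 2) (Fin 2) ℤ) (ℓ : LaxVector) :
    laxMap (M * N) ℓ = laxMap M (laxMap N ℓ) := by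
  induction ℓ using Quotient.inductionOn with
  | h v => exact congrArg lax (Matrix.mulVec_mulVec v M N).symm

theorem IsSuperbase.image {S : Set LaxVector} (h : IsSuperbase S) (g : GL (Fin 2) ℤ) :
    IsSuperbase (laxMap g.val '' S) := by
  obtain ⟨e₁, e₂, e₃, hb, hs, rfl⟩ := h
  refine ⟨g.val *ᵥ e₁, g.val *ᵥ e₂, g.val *ᵥ e₃, hb.mulVec g, ?_, ?_⟩
  · rw [← Matrix.mulVec_add, ← Matrix.mulVec_add, hs, Matrix.mulVec_zero]
  · simp only [Set.image_insert_eq, Set.image_singleton, laxMap_lax]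

/-- `GL(2, ℤ)` acts on superbases by `g • {±e₁, ±e₂, ±e₃} = {±g e₁, ±g e₂, ±g e₃}`. -/
instance glAction : MulAction (GL (Fin 2) ℤ) Superbase where
  smul g S := ⟨laxMap g.val '' S.1, S.2.image g⟩
  one_smul S := Subtype.ext (by
    change laxMap (1 : GL (Fin 2) ℤ).val '' S.1 = S.1
    rw [Units.val_one, funext laxMap_one, Set.image_id'])
  mul_smul g h S := Subtype.ext (by
    change laxMap (g * h).val '' S.1 = laxMap g.val '' (laxMap h.val '' S.1)
    rw [Units.val_mul, funext (laxMap_mul g.val h.val), Set.image_image])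

theorem scalar_smul (c : ℤˣ) (S : Superbase) :
    Matrix.GeneralLinearGroup.scalar (Fin 2) c • S = S := by
  apply Subtype.ext
  change laxMap (Matrix.GeneralLinearGroup.scalar (Fin 2) c).val '' S.1 = S.1
  have h : laxMap (Matrix.GeneralLinearGroup.scalar (Fin 2) c).val = id := by
    funext ℓ
    induction ℓ using Quotient.inductionOn with
    | h v =>
      change lax (_ *ᵥ v) = lax v
      rcases Int.units_eq_one_or c with rfl | rfl
      · simp
      · have : (Matrix.GeneralLinearGroup.scalar (Fin 2) (-1 : ℤˣ)).val *ᵥ v = -v := by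
          ext i
          fin_cases i <;> simp
        rw [this, lax_neg]
  rw [h, Set.image_id]

/-- The action of `PGL(2, ℤ)` on the superbase tree. -/
instance pglAction : MulAction PGL(2, ℤ) Superbase :=
  Matrix.ProjGenLinGroup.mulActionOfGL scalar_smul

/-- The paths `p` and `p'` agree up to the action of `PGL(2, ℤ)` and a change of direction (the
parametrizations of paths being defined only up to a shift). -/
def PathEquiv (p p' : ℤ → Superbase) : Prop :=
  ∃ g : PGL(2, ℤ), ∃ k : ℤ, (∀ n, p' n = g • p (n + k)) ∨ (∀ n, p' n = g • p (k - n))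

end ConwaySail

open ConwaySail

/-!
The river and the sail of an angle `C` are two readings of one sequence of bases of the lattice.

Let `x`, `y` be the coordinates along the sides of `C`, ordered and scaled so that
`det (u, v) = y u * x v - x u * y v`. The form is a multiple of `x * y`, so an edge of the
topograph separates a positive from a negative value exactly when its two regions are represented
by a basis `(u, v)` with `x u, y u, x v > 0 > y v`; such a basis is positively oriented
(`AngleFrame.RiverBasis`). The next edge belongs to `(u, u + v)` after a left turn and to
`(u + v, v)` after a right turn, according to the sign of `y (u + v)`; this step is invertible. Of
any two such bases, one has nonnegative coordinates with respect to the other, and a descent on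
these coordinates shows that they all lie on one orbit (`RiverBasis.exists_seq_eq`). Hence the river
exists, and it is unique up to a shift and a change of direction (`RiverBasis.isRiver_path`,
`IsRiver.pathEquiv`).

The turns of the river change side infinitely often in both directions. During a block of right
turns the vector `u` runs through the integer points of a segment of direction `v`, and during a
block of left turns `v` is increased by multiples of `u`. With `A k` and `V k` the values of
`u` and `v` at the beginning of the right blocks, this gives `A (k + 1) = A k + a (2 k) V k` and
`V k = V (k - 1) + a (2 k - 1) A k`, where `a` lists the lengths of the blocks
(`AngleFrame.SailChain`); so `a` consists of the integer lengths and sines of the broken line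
through the points `A k`.

This broken line is the sail: `det (·, V k)` is a positive integer at every integer point of `C`
and equal to `1` on the `k`-th edge, so every edge is on the boundary of the convex hull.
Conversely the cones over the edges fill `C`, since the points `A k` tend to the directions of the
two sides, and above the edges the hull is open because it absorbs the vectors of `C`
(`SailChain.sail_eq`, `SailChain.extremePoints_hull`). The same functionals show that two vertices
are neighbours on the sail only if their indices are consecutive, which determines the numbering up
to a shift and a reflection (`SailChain.exists_eq_comp`, `SailChain.seqEquiv_of_isLLS`).

Finally, a directed edge of the tree together with a sequence of turns determines a path, and
`GL(2, ℤ)` acts transitively on directed edges, matrices of determinant `-1` exchanging left and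
right; so paths with the same turns are equivalent (`TurnsCoincide.exists_smul_eq`).
-/

namespace ConwaySail

/-! ### Integer vectors and determinants -/

theorem latDet_self (u : IntPoint) : latDet u u = 0 := by
  unfold latDet; ring

theorem latDet_swap (u v : IntPoint) : latDet v u = -latDet u v := by
  unfold latDet; ring

theorem latDet_add_left (u v w : IntPoint) : latDet (u + v) w = latDet u w + latDet v w := by
  simp only [latDet, Pi.add_apply]; ring

theorem latDet_add_right (u v w : IntPoint) : latDet u (v + w) = latDet u v + latDet u w := by
  simp only [latDet, Pi.add_apply]; ring

theorem latDet_neg_left (u v : IntPoint) : latDet (-u) v = -latDet u v := by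
  simp only [latDet, Pi.neg_apply]; ring

theorem latDet_neg_right (u v : IntPoint) : latDet u (-v) = -latDet u v := by
  simp only [latDet, Pi.neg_apply]; ring

theorem latDet_sub_left (u v w : IntPoint) : latDet (u - v) w = latDet u w - latDet v w := by
  simp only [latDet, Pi.sub_apply]; ring

theorem latDet_sub_right (u v w : IntPoint) : latDet u (v - w) = latDet u v - latDet u w := by
  simp only [latDet, Pi.sub_apply]; ring

theorem latDet_smul_left (n : ℤ) (u v : IntPoint) : latDet (n • u) v = n * latDet u v := by
  simp only [latDet, Pi.smul_apply, smul_eq_mul]; ring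

theorem latDet_smul_right (n : ℤ) (u v : IntPoint) : latDet u (n • v) = n * latDet u v := by
  simp only [latDet, Pi.smul_apply, smul_eq_mul]; ring

/-- Cramer's rule in the plane. -/
theorem latDet_smul_eq (u v w : IntPoint) :
    latDet u v • w = latDet w v • u + latDet u w • v := by
  funext i
  fin_cases i <;> simp [latDet] <;> ring

theorem latDet_mulVec (M : Matrix (Fin 2) (Fin 2) ℤ) (u v : IntPoint) :
    latDet (M *ᵥ u) (M *ᵥ v) = M.det * latDet u v := by
  simp only [latDet, Matrix.mulVec, dotProduct, Fin.sum_univ_two, Matrix.det_fin_two]; ring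

theorem exists_gl_mulVec_std {u v : IntPoint} (h : IsUnit (latDet u v)) :
    ∃ g : GL (Fin 2) ℤ, g.val *ᵥ ![1, 0] = u ∧ g.val *ᵥ ![0, 1] = v := by
  have hd : IsUnit (!![u 0, v 0; u 1, v 1] : Matrix (Fin 2) (Fin 2) ℤ).det := by
    rw [Matrix.det_fin_two_of]
    convert h using 1
    unfold latDet; ring
  refine ⟨Matrix.GeneralLinearGroup.mk'' _ hd, ?_, ?_⟩ <;>
  · change (!![u 0, v 0; u 1, v 1] : Matrix (Fin 2) (Fin 2) ℤ) *ᵥ _ = _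
    funext i
    fin_cases i <;> simp [Matrix.mulVec, dotProduct]

/-- `GL(2, ℤ)` acts transitively on the bases of the lattice. -/
theorem exists_gl_mulVec {u v u' v' : IntPoint} (h : IsUnit (latDet u v))
    (h' : IsUnit (latDet u' v')) :
    ∃ g : GL (Fin 2) ℤ, g.val *ᵥ u = u' ∧ g.val *ᵥ v = v' := by
  obtain ⟨g, rfl, rfl⟩ := exists_gl_mulVec_std h
  obtain ⟨g', rfl, rfl⟩ := exists_gl_mulVec_std h'
  refine ⟨g' * g⁻¹, ?_, ?_⟩ <;>
  · rw [Units.val_mul, Matrix.mulVec_mulVec, Matrix.mul_assoc, ← Units.val_mul, inv_mul_cancel,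
      Units.val_one, Matrix.mul_one]

theorem isLatticeBasis_iff {u v : IntPoint} : IsLatticeBasis u v ↔ IsUnit (latDet u v) := by
  constructor
  · rintro ⟨b, rfl, rfl⟩
    have h := (Pi.basisFun ℤ (Fin 2)).isUnit_det b
    rw [Module.Basis.det_apply, Matrix.det_fin_two] at h
    have e : latDet (b 0) (b 1) = b 0 0 * b 1 1 - b 1 0 * b 0 1 := by unfold latDet; ring
    rw [e]
    simpa [Module.Basis.toMatrix_apply] using h
  · intro h
    obtain ⟨g, rfl, rfl⟩ := exists_gl_mulVec_std h
    refine IsLatticeBasis.mulVec ⟨Pi.basisFun ℤ (Fin 2), ?_, ?_⟩ g <;>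
    · funext i
      fin_cases i <;> simp [Pi.basisFun_apply]

/-- The index of the sublattice spanned by two vectors is the absolute value of their
determinant. -/
theorem index_closure_pair {u v : IntPoint} (h : latDet u v ≠ 0) :
    (AddSubgroup.closure ({u, v} : Set IntPoint)).index = (latDet u v).natAbs := by
  have hli : LinearIndependent ℤ ![u, v] := by
    rw [LinearIndependent.pair_iff]
    intro s t hst
    have h1 : latDet (s • u + t • v) v = 0 := by rw [hst]; simp [latDet]
    have h2 : latDet u (s • u + t • v) = 0 := by rw [hst]; simp [latDet]
    rw [latDet_add_left, latDet_smul_left, latDet_smul_left, latDet_self, mul_zero, add_zero] at h1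
    rw [latDet_add_right, latDet_smul_right, latDet_smul_right, latDet_self, mul_zero,
      zero_add] at h2
    exact ⟨(mul_eq_zero.1 h1).resolve_right h, (mul_eq_zero.1 h2).resolve_right h⟩
  have key := Submodule.natAbs_det_basis_change (Pi.basisFun ℤ (Fin 2)) _
    (Module.Basis.span hli)
  have hr : Set.range ![u, v] = {u, v} := by simp [Set.pair_comm]
  have hs : (Submodule.span ℤ (Set.range ![u, v])).toAddSubgroup
      = AddSubgroup.closure ({u, v} : Set IntPoint) := by
    rw [Submodule.span_int_eq_addSubgroupClosure, hr]
  rw [← hs]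
  refine Eq.trans key.symm ?_
  rw [Module.Basis.det_apply, Matrix.det_fin_two]
  congr 1
  simp [latDet, Module.Basis.toMatrix_apply, Module.Basis.span_apply]
  ring

/-! ### Lax vectors, superbases and turns -/

theorem lax_eq_lax {u v : IntPoint} : lax u = lax v ↔ u = v ∨ u = -v :=
  Quotient.eq (r := laxSetoid)

theorem lax_sub_comm (u v : IntPoint) : lax (u - v) = lax (v - u) := by
  rw [← lax_neg, neg_sub]

/-- The superbase `{±u, ±v, ±(u + v)}`. -/
def superbase (u v : IntPoint) (h : IsUnit (latDet u v)) : Superbase :=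
  ⟨{lax u, lax v, lax (u + v)}, u, v, -(u + v), isLatticeBasis_iff.2 h, add_neg_cancel _, by
    rw [lax_neg]⟩

/-- Two distinct members of a superbase form a basis, and the third one is their sum or their
difference. -/
theorem Superbase.eq_of_mem {S : Superbase} {u v : IntPoint} (hu : lax u ∈ S.1)
    (hv : lax v ∈ S.1) (hne : lax u ≠ lax v) :
    IsUnit (latDet u v) ∧
      (S.1 = {lax u, lax v, lax (u + v)} ∨ S.1 = {lax u, lax v, lax (u - v)}) := by
  obtain ⟨S, e₁, e₂, e₃, hb, hs, hS⟩ := S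
  change lax u ∈ S at hu
  change lax v ∈ S at hv
  change _ ∧ (S = _ ∨ S = _)
  have hd := isLatticeBasis_iff.1 hb
  have key : ∀ a b c : IntPoint, IsUnit (latDet a b) → a + b + c = 0 →
      S = {lax a, lax b, lax c} → lax u = lax a → lax v = lax b →
      IsUnit (latDet u v) ∧
        (S = {lax u, lax v, lax (u + v)} ∨ S = {lax u, lax v, lax (u - v)}) := by
    intro a b c hab hc hS ha hb
    obtain rfl : c = -(a + b) := by
      rw [eq_neg_iff_add_eq_zero, add_comm]; exact hc
    rw [lax_neg] at hS
    rcases lax_eq_lax.1 ha with rfl | rfl <;> rcases lax_eq_lax.1 hb with rfl | rfl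
    · exact ⟨hab, Or.inl hS⟩
    · exact ⟨by rwa [latDet_neg_right, IsUnit.neg_iff],
        Or.inr (by rw [hS, lax_neg, sub_neg_eq_add])⟩
    · refine ⟨by rwa [latDet_neg_left, IsUnit.neg_iff], Or.inr ?_⟩
      rw [hS, lax_neg, ← neg_add', lax_neg]
    · refine ⟨by rwa [latDet_neg_left, latDet_neg_right, neg_neg], Or.inl ?_⟩
      rw [hS, lax_neg, lax_neg, ← neg_add, lax_neg]
  obtain rfl : e₃ = -(e₁ + e₂) := by
    rw [eq_neg_iff_add_eq_zero, add_comm]; exact hs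
  have units : ∀ m : ℤ, m = latDet e₁ e₂ ∨ m = -latDet e₁ e₂ → IsUnit m := by
    rintro m (rfl | rfl)
    · exact hd
    · rwa [IsUnit.neg_iff]
  have h21 := latDet_swap e₁ e₂
  simp only [hS, Set.mem_insert_iff, Set.mem_singleton_iff] at hu hv
  have solve : ∀ a b c : IntPoint, (latDet a b = latDet e₁ e₂ ∨ latDet a b = -latDet e₁ e₂) →
      a + b + c = e₁ + e₂ + -(e₁ + e₂) →
      (∀ m, m = lax a ∨ m = lax b ∨ m = lax c ↔ m = lax e₁ ∨ m = lax e₂ ∨ m = lax (-(e₁ + e₂))) →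
      lax u = lax a → lax v = lax b → IsUnit (latDet u v) ∧
        (S = {lax u, lax v, lax (u + v)} ∨ S = {lax u, lax v, lax (u - v)}) :=
    fun a b c hab hc hm => key a b c (units _ hab) (hc.trans hs) (by
      ext m; simpa [hS] using (hm m).symm)
  rcases hu with hu | hu | hu <;> rcases hv with hv | hv | hv
  · exact absurd (hu.trans hv.symm) hne
  · exact solve _ _ (-(e₁ + e₂)) (Or.inl rfl) rfl (fun m => Iff.rfl) hu hv
  · refine solve _ _ e₂ (Or.inr ?_) (by abel) (fun m => by tauto) hu hv
    rw [latDet_neg_right, latDet_add_right, latDet_self, zero_add]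
  · exact solve _ _ (-(e₁ + e₂)) (Or.inr (latDet_swap _ _)) (by abel) (fun m => by tauto) hu hv
  · exact absurd (hu.trans hv.symm) hne
  · refine solve _ _ e₁ (Or.inl ?_) (by abel) (fun m => by tauto) hu hv
    rw [latDet_neg_right, latDet_add_right, latDet_self, h21, add_zero, neg_neg]
  · refine solve _ _ e₂ (Or.inl ?_) (by abel) (fun m => by tauto) hu hv
    rw [latDet_neg_left, latDet_add_left, latDet_self, h21, zero_add, neg_neg]
  · refine solve _ _ e₁ (Or.inr ?_) (by abel) (fun m => by tauto) hu hv
    rw [latDet_neg_left, latDet_add_left, latDet_self, add_zero]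
  · exact absurd (hu.trans hv.symm) hne

theorem coords_of_eq {u v w : IntPoint} {m n : ℤ} (h : latDet u v = 1) (hm : latDet w v = m)
    (hn : latDet u w = n) : w = m • u + n • v := by
  have := latDet_smul_eq u v w
  rwa [h, one_smul, hm, hn] at this

theorem coords_of_mem_superbase {u v w : IntPoint} (h : latDet u v = 1)
    (hw : lax w ∈ ({lax u, lax v, lax (u + v)} : Set LaxVector)) :
    (latDet w v = 1 ∧ latDet u w = 0) ∨ (latDet w v = -1 ∧ latDet u w = 0) ∨
    (latDet w v = 0 ∧ latDet u w = 1) ∨ (latDet w v = 0 ∧ latDet u w = -1) ∨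
    (latDet w v = 1 ∧ latDet u w = 1) ∨ (latDet w v = -1 ∧ latDet u w = -1) := by
  simp only [Set.mem_insert_iff, Set.mem_singleton_iff, lax_eq_lax] at hw
  rcases hw with (rfl | rfl) | (rfl | rfl) | (rfl | rfl) <;>
    simp [latDet_neg_left, latDet_neg_right, latDet_add_left, latDet_add_right, latDet_self, h]

theorem coords_of_mem_superbase_sub {u v w : IntPoint} (h : latDet u v = 1)
    (hw : lax w ∈ ({lax u, lax v, lax (u - v)} : Set LaxVector)) :
    (latDet w v = 1 ∧ latDet u w = 0) ∨ (latDet w v = -1 ∧ latDet u w = 0) ∨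
    (latDet w v = 0 ∧ latDet u w = 1) ∨ (latDet w v = 0 ∧ latDet u w = -1) ∨
    (latDet w v = 1 ∧ latDet u w = -1) ∨ (latDet w v = -1 ∧ latDet u w = 1) := by
  simp only [Set.mem_insert_iff, Set.mem_singleton_iff, lax_eq_lax] at hw
  rcases hw with (rfl | rfl) | (rfl | rfl) | (rfl | rfl) <;>
    simp [latDet_neg_left, latDet_neg_right, latDet_sub_left, latDet_sub_right, latDet_self, h]

/-- A directed edge determines the two regions on its left and on its right, with their signs up
to a common change. -/
theorem directedEdge_unique {S T : Superbase} {u v u' v' : IntPoint}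
    (h : latDet u v = 1) (hS : S.1 = {lax u, lax v, lax (u - v)})
    (hT : T.1 = {lax u, lax v, lax (u + v)})
    (h' : latDet u' v' = 1) (hS' : S.1 = {lax u', lax v', lax (u' - v')})
    (hT' : T.1 = {lax u', lax v', lax (u' + v')}) :
    (u' = u ∧ v' = v) ∨ (u' = -u ∧ v' = -v) := by
  have a1 := coords_of_mem_superbase h (w := u') (by rw [← hT, hT']; simp)
  have a2 := coords_of_mem_superbase_sub h (w := u') (by rw [← hS, hS']; simp)
  have b1 := coords_of_mem_superbase h (w := v') (by rw [← hT, hT']; simp)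
  have b2 := coords_of_mem_superbase_sub h (w := v') (by rw [← hS, hS']; simp)
  have c1 := coords_of_mem_superbase h (w := u' + v') (by rw [← hT, hT']; simp)
  rw [latDet_add_left, latDet_add_right] at c1
  have hdet : latDet u' v' = latDet u' v * latDet u v' - latDet u u' * latDet v' v := by
    have h1 := coords_of_eq h (w := u') rfl rfl
    have h2 := coords_of_eq h (w := v') rfl rfl
    conv_lhs => rw [h1, h2]
    simp only [latDet_add_left, latDet_add_right, latDet_smul_left, latDet_smul_right, latDet_self,
      latDet_swap u v, h]
    ring
  rw [h'] at hdet
  have main : (latDet u' v = 1 ∧ latDet u u' = 0 ∧ latDet v' v = 0 ∧ latDet u v' = 1) ∨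
      (latDet u' v = -1 ∧ latDet u u' = 0 ∧ latDet v' v = 0 ∧ latDet u v' = -1) := by
    have a : (latDet u' v = 1 ∧ latDet u u' = 0) ∨ (latDet u' v = -1 ∧ latDet u u' = 0) ∨
      (latDet u' v = 0 ∧ latDet u u' = 1) ∨ (latDet u' v = 0 ∧ latDet u u' = -1) := by omega
    rcases a with ⟨p, q⟩ | ⟨p, q⟩ | ⟨p, q⟩ | ⟨p, q⟩ <;> rw [p, q] at hdet <;> omega
  rcases main with ⟨p, q, r, s⟩ | ⟨p, q, r, s⟩
  · left
    constructor
    · simpa using coords_of_eq h p q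
    · simpa using coords_of_eq h r s
  · right
    constructor
    · simpa using coords_of_eq h p q
    · simpa using coords_of_eq h r s

theorem LeftTurn.unique {S T U U' : Superbase} (h : LeftTurn S T U) (h' : LeftTurn S T U') :
    U = U' := by
  obtain ⟨u, v, hd, hS, hT, hU⟩ := h
  obtain ⟨u', v', hd', hS', hT', hU'⟩ := h'
  apply Subtype.ext
  rw [hU, hU']
  rcases directedEdge_unique hd hS hT hd' hS' hT' with ⟨rfl, rfl⟩ | ⟨rfl, rfl⟩
  · rfl
  · simp only [← neg_add, lax_neg]

theorem LeftTurn.reverse {S T U : Superbase} (h : LeftTurn S T U) : RightTurn U T S := by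
  obtain ⟨u, v, hd, hS, hT, hU⟩ := h
  refine ⟨u + v, -u, ?_, ?_, ?_, ?_⟩
  · rw [latDet_neg_right, latDet_add_left, latDet_self, latDet_swap u v, hd]; norm_num
  · rw [hU, lax_neg, sub_neg_eq_add, Set.insert_comm, add_comm u (u + v)]
  · rw [hT, lax_neg, show u + v + -u = v by abel, Set.insert_comm, Set.pair_comm (lax u),
      Set.insert_comm, Set.pair_comm (lax u)]
  · rw [hS, lax_neg, show u + v + -u = v by abel, ← sub_eq_add_neg, lax_sub_comm v]

theorem RightTurn.reverse {S T U : Superbase} (h : RightTurn S T U) : LeftTurn U T S := by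
  obtain ⟨u, v, hd, hS, hT, hU⟩ := h
  refine ⟨v, -(u + v), ?_, ?_, ?_, ?_⟩
  · rw [latDet_neg_right, latDet_add_right, latDet_self, latDet_swap u v, hd]; norm_num
  · rw [hU, lax_neg, sub_neg_eq_add, add_comm v (u + v)]
  · rw [hT, lax_neg, show v + -(u + v) = -u by abel, lax_neg, Set.insert_comm,
      Set.pair_comm (lax u)]
  · rw [hS, show v + -(u + v) = -u by abel, lax_neg, ← sub_eq_add_neg, lax_sub_comm v,
      Set.insert_comm]

theorem RightTurn.unique {S T U U' : Superbase} (h : RightTurn S T U) (h' : RightTurn S T U') :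
    U = U' := by
  obtain ⟨u, v, hd, hS, hT, hU⟩ := h
  obtain ⟨u', v', hd', hS', hT', hU'⟩ := h'
  apply Subtype.ext
  rw [hU, hU']
  rcases directedEdge_unique hd hS hT hd' hS' hT' with ⟨rfl, rfl⟩ | ⟨rfl, rfl⟩
  · rfl
  · simp only [← neg_add, lax_neg]

theorem smul_val (g : GL (Fin 2) ℤ) (S : Superbase) : (g • S).1 = laxMap g.val '' S.1 := rfl

theorem smul_val_eq (g : GL (Fin 2) ℤ) {S : Superbase} {a b c : IntPoint}
    (h : S.1 = {lax a, lax b, lax c}) :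
    (g • S).1 = {lax (g.val *ᵥ a), lax (g.val *ᵥ b), lax (g.val *ᵥ c)} := by
  rw [smul_val, h, Set.image_insert_eq, Set.image_insert_eq, Set.image_singleton]
  rfl

theorem LeftTurn.smul {S T U : Superbase} (h : LeftTurn S T U) (g : GL (Fin 2) ℤ) :
    (g.val.det = 1 → LeftTurn (g • S) (g • T) (g • U)) ∧
    (g.val.det = -1 → RightTurn (g • S) (g • T) (g • U)) := by
  obtain ⟨u, v, hd, hS, hT, hU⟩ := h
  constructor <;> intro hg
  · refine ⟨g.val *ᵥ u, g.val *ᵥ v, by rw [latDet_mulVec, hg, hd]; rfl, ?_, ?_, ?_⟩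
    · rw [smul_val_eq g hS, Matrix.mulVec_sub]
    · rw [smul_val_eq g hT, Matrix.mulVec_add]
    · simp only [smul_val_eq g hU, Matrix.mulVec_add]
  · refine ⟨g.val *ᵥ v, g.val *ᵥ u, by
      rw [latDet_mulVec, hg, latDet_swap u v, hd]; rfl, ?_, ?_, ?_⟩
    · rw [smul_val_eq g hS, Matrix.mulVec_sub, lax_sub_comm, Set.insert_comm]
    · rw [smul_val_eq g hT, Matrix.mulVec_add, Set.insert_comm, add_comm]
    · rw [smul_val_eq g hU, Matrix.mulVec_add g.val u (u + v), Matrix.mulVec_add,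
        add_comm (g.val *ᵥ v), add_comm _ (g.val *ᵥ u)]

theorem RightTurn.smul {S T U : Superbase} (h : RightTurn S T U) (g : GL (Fin 2) ℤ) :
    (g.val.det = 1 → RightTurn (g • S) (g • T) (g • U)) ∧
    (g.val.det = -1 → LeftTurn (g • S) (g • T) (g • U)) :=
  ⟨fun hg => ((h.reverse.smul g).1 hg).reverse, fun hg => ((h.reverse.smul g).2 hg).reverse⟩

/-! ### Sequences of integers -/

/-- An injective walk on the integers with steps of length one is a shift or a reflection. -/
theorem eq_shift_or_reflection {σ : ℤ → ℤ} (hinj : Function.Injective σ)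
    (hstep : ∀ n, σ (n + 1) = σ n + 1 ∨ σ (n + 1) = σ n - 1) :
    ∃ k, (∀ n, σ n = n + k) ∨ (∀ n, σ n = k - n) := by
  have hconst : ∀ n, σ (n + 1) - σ n = σ 1 - σ 0 := by
    have hsucc : ∀ n, σ (n + 1 + 1) - σ (n + 1) = σ (n + 1) - σ n := by
      intro n
      have hne : σ (n + 1 + 1) ≠ σ n := fun h => by have := hinj h; omega
      rcases hstep n with h | h <;> rcases hstep (n + 1) with h' | h' <;> omega
    intro n
    induction n using Int.induction_on with
    | zero => simp
    | succ n ih => rw [hsucc, ih]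
    | pred n ih =>
      have := hsucc (-(n : ℤ) - 1)
      rw [sub_add_cancel] at this
      rw [sub_add_cancel, ← this, ih]
  have hlin : ∀ n, σ n = σ 0 + n * (σ 1 - σ 0) := by
    intro n
    induction n using Int.induction_on with
    | zero => simp
    | succ n ih => linear_combination ih + hconst n
    | pred n ih =>
      have := hconst (-(n : ℤ) - 1)
      rw [sub_add_cancel] at this
      linear_combination ih - this
  refine ⟨σ 0, ?_⟩
  rcases hstep 0 with h | h
  · refine Or.inl fun n => ?_
    rw [hlin n, show σ 1 = σ 0 + 1 from h]; ring
  · refine Or.inr fun n => ?_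
    rw [hlin n, show σ 1 = σ 0 - 1 from h]; ring

/-- The intervals between consecutive terms of a strictly increasing sequence cover `ℤ`. -/
theorem exists_mem_block {c : ℤ → ℤ} (hc : ∀ i, c i < c (i + 1)) (j : ℤ) :
    ∃ i, c i ≤ j ∧ j < c (i + 1) := by
  have hm : Monotone fun i => c i - i := monotone_int_of_le_succ fun i => by
    have := hc i; omega
  obtain ⟨i, hi, hmax⟩ := Int.exists_greatest_of_bdd (P := fun i => c i ≤ j)
    ⟨max 0 (j - c 0), fun z hz => by
      by_contra! h
      have h1 : c 0 - 0 ≤ c z - z := hm ((le_max_left _ _).trans h.le)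
      have h2 := (le_max_right 0 (j - c 0)).trans_lt h
      omega⟩
    ⟨min 0 (j - c 0), by
      have h1 : c (min 0 (j - c 0)) - min 0 (j - c 0) ≤ c 0 - 0 := hm (min_le_left _ _)
      have h2 := min_le_right 0 (j - c 0)
      omega⟩
  refine ⟨i, hi, ?_⟩
  by_contra! h
  have := hmax _ h
  omega

theorem SeqEquiv.symm {a a' : ℤ → ℕ} (h : SeqEquiv a a') : SeqEquiv a' a := by
  obtain ⟨k, h | h⟩ := h
  · exact ⟨-k, Or.inl fun i => by rw [h, neg_add_cancel_right]⟩
  · exact ⟨k, Or.inr fun i => by rw [h, sub_sub_cancel]⟩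

/-! ### Turns and their symmetries -/

/-- A turn of the given side, `true` standing for left. -/
def Turn : Bool → Superbase → Superbase → Superbase → Prop
  | true => LeftTurn
  | false => RightTurn

/-- The side of the turns of the `i`-th block, when the turns of block `0` are on side `s`. -/
def side (s : Bool) (i : ℤ) : Bool := if Even i then s else !s

theorem side_add (s : Bool) (i k : ℤ) : side s (i + k) = side (side s k) i := by
  unfold side
  by_cases hi : Even i <;> by_cases hk : Even k <;> simp [Int.even_add, hi, hk]

theorem side_neg (s : Bool) (i : ℤ) : side s (-i) = side s i := by
  unfold side; simp

theorem side_xor (s b : Bool) (i : ℤ) : (side s i ^^ b) = side (s ^^ b) i := by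
  unfold side
  by_cases hi : Even i <;> simp [hi]

theorem turnsCoincide_iff {p : ℤ → Superbase} {a : ℤ → ℕ} :
    TurnsCoincide p a ↔ (∀ i, 0 < a i) ∧ ∃ (c : ℤ → ℤ) (s : Bool),
      (∀ i, c (i + 1) = c i + a i) ∧
      ∀ i j, c i ≤ j → j < c (i + 1) → Turn (side s i) (p (j - 1)) (p j) (p (j + 1)) := by
  have aux : ∀ s i j, (Turn (side s i) (p (j - 1)) (p j) (p (j + 1)) ↔
      (Even i → Turn s (p (j - 1)) (p j) (p (j + 1))) ∧
      (Odd i → Turn (!s) (p (j - 1)) (p j) (p (j + 1)))) := by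
    intro s i j
    unfold side
    by_cases hi : Even i
    · simp [hi]
    · simp [hi, Int.not_even_iff_odd.1 hi]
  refine and_congr_right fun _ => exists_congr fun c => ?_
  simp only [aux, exists_and_left, Bool.exists_bool]
  exact and_congr_right fun _ => or_comm

theorem Turn.reverse {s : Bool} {S T U : Superbase} (h : Turn s S T U) : Turn (!s) U T S := by
  cases s
  · exact RightTurn.reverse h
  · exact LeftTurn.reverse h

theorem Turn.unique {s : Bool} {S T U U' : Superbase} (h : Turn s S T U) (h' : Turn s S T U') :
    U = U' := by
  cases s
  · exact RightTurn.unique h h'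
  · exact LeftTurn.unique h h'

theorem Turn.smul {s : Bool} {S T U : Superbase} (h : Turn s S T U) (g : GL (Fin 2) ℤ) :
    Turn (s ^^ decide (g.val.det = -1)) (g • S) (g • T) (g • U) := by
  have hg : g.val.det = 1 ∨ g.val.det = -1 := Int.isUnit_iff.1 ⟨_, g.val_det_apply⟩
  cases s <;> rcases hg with hg | hg <;> simp only [hg]
  · exact (RightTurn.smul h g).1 hg
  · exact (RightTurn.smul h g).2 hg
  · exact (LeftTurn.smul h g).1 hg
  · exact (LeftTurn.smul h g).2 hg

theorem Turn.exists_basis {s : Bool} {S T U : Superbase} (h : Turn s S T U) :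
    ∃ u v : IntPoint, latDet u v = 1 ∧ S.1 = {lax u, lax v, lax (u - v)} ∧
      T.1 = {lax u, lax v, lax (u + v)} := by
  cases s
  · obtain ⟨u, v, h1, h2, h3, -⟩ := h
    exact ⟨u, v, h1, h2, h3⟩
  · obtain ⟨u, v, h1, h2, h3, -⟩ := h
    exact ⟨u, v, h1, h2, h3⟩

/-- Any two directed edges of the tree differ by an element of `GL(2, ℤ)`, of either prescribed
determinant. -/
theorem Turn.exists_smul_eq {s s' : Bool} {S T U S' T' U' : Superbase} (h : Turn s S T U)
    (h' : Turn s' S' T' U') (b : Bool) :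
    ∃ g : GL (Fin 2) ℤ, g • S = S' ∧ g • T = T' ∧ decide (g.val.det = -1) = b := by
  obtain ⟨u, v, hd, hS, hT⟩ := h.exists_basis
  obtain ⟨u', v', hd', hS', hT'⟩ := h'.exists_basis
  cases b
  · obtain ⟨g, rfl, rfl⟩ := exists_gl_mulVec (u := u) (v := v) (u' := u') (v' := v')
      (by rw [hd]; exact isUnit_one) (by rw [hd']; exact isUnit_one)
    refine ⟨g, Subtype.ext ?_, Subtype.ext ?_, ?_⟩
    · rw [hS', smul_val_eq g hS, Matrix.mulVec_sub]
    · rw [hT', smul_val_eq g hT, Matrix.mulVec_add]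
    · rw [latDet_mulVec, hd, mul_one] at hd'
      simp [hd']
  · obtain ⟨g, hv, hu⟩ := exists_gl_mulVec (u := u) (v := v) (u' := v') (v' := u')
      (by rw [hd]; exact isUnit_one) (by rw [latDet_swap, hd']; exact isUnit_one.neg)
    subst hv hu
    refine ⟨g, Subtype.ext ?_, Subtype.ext ?_, ?_⟩
    · rw [hS', smul_val_eq g hS, Matrix.mulVec_sub, lax_sub_comm, Set.insert_comm]
    · rw [hT', smul_val_eq g hT, Matrix.mulVec_add, add_comm, Set.insert_comm]
    · rw [latDet_mulVec, latDet_swap u v, hd] at hd'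
      simp only [decide_eq_true_eq]
      omega

/-! ### Paths with a given sequence of turns -/

theorem reversePath_reversePath (p : ℤ → Superbase) : reversePath (reversePath p) = p := by
  funext n
  simp [reversePath]

theorem TurnsCoincide.shift_path {p : ℤ → Superbase} {a : ℤ → ℕ} (h : TurnsCoincide p a) (m : ℤ) :
    TurnsCoincide (fun n => p (n + m)) a := by
  rw [turnsCoincide_iff] at h ⊢
  obtain ⟨ha, c, s, hc, ht⟩ := h
  refine ⟨ha, fun i => c i - m, s, fun i => by simp only [hc]; ring, fun i j h1 h2 => ?_⟩
  have := ht i (j + m) (by linarith) (by linarith)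
  rwa [show j + m - 1 = j - 1 + m by ring, show j + m + 1 = j + 1 + m by ring] at this

theorem TurnsCoincide.shift_seq {p : ℤ → Superbase} {a : ℤ → ℕ} (h : TurnsCoincide p a) (k : ℤ) :
    TurnsCoincide p (fun i => a (i + k)) := by
  rw [turnsCoincide_iff] at h ⊢
  obtain ⟨ha, c, s, hc, ht⟩ := h
  refine ⟨fun i => ha _, fun i => c (i + k), side s k, fun i => ?_, fun i j h1 h2 => ?_⟩
  · rw [← hc, add_right_comm]
  · rw [← side_add]
    exact ht (i + k) j h1 (by rwa [add_right_comm])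

theorem TurnsCoincide.reverse {p : ℤ → Superbase} {a : ℤ → ℕ} (h : TurnsCoincide p a) :
    TurnsCoincide (reversePath p) (fun i => a (-i)) := by
  rw [turnsCoincide_iff] at h ⊢
  obtain ⟨ha, c, s, hc, ht⟩ := h
  refine ⟨fun i => ha _, fun i => 1 - c (1 - i), !s, fun i => ?_, fun i j h1 h2 => ?_⟩
  · have := hc (-i)
    rw [show -i + 1 = 1 - i by ring] at this
    simp only [show 1 - (i + 1) = -i by ring, this]; ring
  · simp only at h1 h2
    have h3 := (ht (-i) (-j) (by rw [show 1 - (i + 1) = -i by ring] at h2; linarith)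
      (by rw [show -i + 1 = 1 - i by ring]; linarith)).reverse
    rw [side_neg, ← Bool.xor_true, side_xor, Bool.xor_true] at h3
    simp only [reversePath]
    rwa [show -(j - 1) = -j + 1 by ring, show -(j + 1) = -j - 1 by ring]

theorem TurnsCoincide.smul {p : ℤ → Superbase} {a : ℤ → ℕ} (h : TurnsCoincide p a)
    (g : PGL(2, ℤ)) : TurnsCoincide (fun n => g • p n) a := by
  obtain ⟨g, rfl⟩ := Matrix.ProjGenLinGroup.mk_surjective g
  rw [turnsCoincide_iff] at h ⊢
  obtain ⟨ha, c, s, hc, ht⟩ := h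
  refine ⟨ha, c, s ^^ decide (g.val.det = -1), hc, fun i j h1 h2 => ?_⟩
  rw [← side_xor]
  exact (ht i j h1 h2).smul g

/-- Two paths with the same sequence of turns differ by an element of `PGL(2, ℤ)` and a shift:
move the directed edge of one path that precedes block `0` to the corresponding edge of the other,
reversing the orientation if block `0` turns to different sides, and follow the turns. -/
theorem TurnsCoincide.exists_smul_eq {p p' : ℤ → Superbase} {a : ℤ → ℕ} (h : TurnsCoincide p a)
    (h' : TurnsCoincide p' a) : ∃ (g : PGL(2, ℤ)) (k : ℤ), ∀ n, p' n = g • p (n + k) := by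
  rw [turnsCoincide_iff] at h h'
  obtain ⟨ha, c, s, hc, ht⟩ := h
  obtain ⟨-, c', s', hc', ht'⟩ := h'
  have hlt : ∀ i, c i < c (i + 1) := fun i => by have := ha i; rw [hc]; omega
  obtain ⟨d, hd⟩ : ∃ d, ∀ i, c' i = c i + d := by
    refine ⟨c' 0 - c 0, fun i => ?_⟩
    induction i using Int.induction_on with
    | zero => ring
    | succ n ih => rw [hc, hc', ih]; ring
    | pred n ih =>
      have h1 := hc (-(n : ℤ) - 1)
      have h2 := hc' (-(n : ℤ) - 1)
      rw [sub_add_cancel] at h1 h2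
      omega
  have hturn' : ∀ i j, c i ≤ j → j < c (i + 1) →
      Turn (side s' i) (p' (j + d - 1)) (p' (j + d)) (p' (j + d + 1)) := fun i j h1 h2 =>
    ht' i (j + d) (by rw [hd]; omega) (by rw [hd]; omega)
  obtain ⟨g, hg0, hg1, hdet⟩ := (ht 0 (c 0) le_rfl (hlt 0)).exists_smul_eq
    (hturn' 0 (c 0) le_rfl (hlt 0)) (s ^^ s')
  have hturn : ∀ i j, c i ≤ j → j < c (i + 1) →
      Turn (side s' i) (g • p (j - 1)) (g • p j) (g • p (j + 1)) := by
    intro i j h1 h2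
    have := (ht i j h1 h2).smul g
    rwa [hdet, side_xor, ← Bool.xor_assoc, Bool.xor_self, Bool.false_xor] at this
  have main : ∀ m, g • p (c 0 + m - 1) = p' (c 0 + m + d - 1) ∧
      g • p (c 0 + m) = p' (c 0 + m + d) := by
    intro m
    induction m using Int.induction_on with
    | zero => simpa using ⟨hg0, hg1⟩
    | succ m ih =>
      obtain ⟨i, h1, h2⟩ := exists_mem_block hlt (c 0 + m)
      have t := hturn i _ h1 h2
      have t' := hturn' i _ h1 h2
      rw [← ih.1, ← ih.2] at t'
      have e := t.unique t'
      rw [show c 0 + ((m : ℤ) + 1) - 1 = c 0 + m by ring,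
        show c 0 + ((m : ℤ) + 1) + d - 1 = c 0 + m + d by ring,
        show c 0 + ((m : ℤ) + 1) = c 0 + m + 1 by ring,
        show c 0 + (m : ℤ) + 1 + d = c 0 + m + d + 1 by ring]
      exact ⟨ih.2, e⟩
    | pred m ih =>
      obtain ⟨i, h1, h2⟩ := exists_mem_block hlt (c 0 + (-m - 1))
      have t := (hturn i _ h1 h2).reverse
      have t' := (hturn' i _ h1 h2).reverse
      have e1 : c 0 + (-(m : ℤ) - 1) + 1 = c 0 + -m := by ring
      have e2 : c 0 + (-(m : ℤ) - 1) + d + 1 = c 0 + -m + d := by ring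
      have e3 : c 0 + (-(m : ℤ) - 1) = c 0 + -m - 1 := by ring
      have e4 : c 0 + (-(m : ℤ) - 1) + d = c 0 + -m + d - 1 := by ring
      have ih1 : g • p (c 0 + (-m - 1)) = p' (c 0 + (-m - 1) + d) := by rw [e4, e3, ih.1]
      rw [e1] at t
      rw [e2, ← ih1, ← ih.2] at t'
      exact ⟨t.unique t', ih1⟩
  refine ⟨Matrix.ProjGenLinGroup.mk g, -d, fun n => ?_⟩
  have := (main (n - d - c 0)).2
  rw [show c 0 + (n - d - c 0) = n + -d by ring, neg_add_cancel_right] at this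
  exact this.symm

/-- The path `p`, in one of its two directions, has the sequence of turns `a`. -/
def HasTurns (p : ℤ → Superbase) (a : ℤ → ℕ) : Prop :=
  TurnsCoincide p a ∨ TurnsCoincide (reversePath p) a

theorem HasTurns.reverse {p : ℤ → Superbase} {a : ℤ → ℕ} (h : HasTurns p a) :
    HasTurns (reversePath p) a := by
  unfold HasTurns
  rw [reversePath_reversePath]
  exact h.symm

theorem HasTurns.of_seqEquiv {p : ℤ → Superbase} {a a' : ℤ → ℕ} (h : HasTurns p a)
    (haa' : SeqEquiv a a') : HasTurns p a' := by
  obtain ⟨k, hk | hk⟩ := haa'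
  · obtain rfl : a' = fun i => a (i + k) := funext hk
    exact h.imp (fun h => h.shift_seq k) (fun h => h.shift_seq k)
  · have e : a' = fun i => a (-(i + -k)) := funext fun i => by rw [hk]; congr 1; ring
    subst e
    rcases h with h | h
    · exact Or.inr (h.reverse.shift_seq (-k))
    · have := h.reverse.shift_seq (-k)
      rw [reversePath_reversePath] at this
      exact Or.inl this

theorem HasTurns.of_pathEquiv {p p' : ℤ → Superbase} {a : ℤ → ℕ} (h : HasTurns p a)
    (hpp' : PathEquiv p p') : HasTurns p' a := by
  obtain ⟨g, k, hk | hk⟩ := hpp'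
  · obtain rfl : p' = fun n => g • p (n + k) := funext hk
    rcases h with h | h
    · exact Or.inl ((h.shift_path k).smul g)
    · refine Or.inr ?_
      convert (h.shift_path (-k)).smul g using 2 with n
      simp only [reversePath]
      congr 2; ring
  · obtain rfl : p' = fun n => g • p (k - n) := funext hk
    rcases h with h | h
    · refine Or.inr ?_
      convert (h.shift_path k).smul g using 2 with n
      simp only [reversePath]
      congr 2; ring
    · refine Or.inl ?_
      convert (h.shift_path (-k)).smul g using 2 with n
      simp only [reversePath]
      congr 2; ring

theorem HasTurns.pathEquiv {p p' : ℤ → Superbase} {a : ℤ → ℕ} (h : HasTurns p a)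
    (h' : HasTurns p' a) : PathEquiv p p' := by
  rcases h with h | h <;> rcases h' with h' | h' <;> obtain ⟨g, k, hk⟩ := h.exists_smul_eq h'
  · exact ⟨g, k, Or.inl hk⟩
  · refine ⟨g, k, Or.inr fun n => ?_⟩
    have := hk (-n)
    simp only [reversePath, neg_neg] at this
    rw [this]; congr 2; ring
  · refine ⟨g, -k, Or.inr fun n => ?_⟩
    rw [hk]; simp only [reversePath]; congr 2; ring
  · refine ⟨g, -k, Or.inl fun n => ?_⟩
    have := hk (-n)
    simp only [reversePath, neg_neg] at this
    rw [this]; congr 2; ring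

/-! ### Blocks of equal letters -/

theorem side_succ (s : Bool) (i : ℤ) : side s (i + 1) = !side s i := by
  unfold side
  by_cases h : Even i <;> simp [h]

/-- A two-sided sequence of two letters in which both letters occur arbitrarily far in both
directions is cut into blocks of equal letters, the blocks of the two letters alternating. -/
theorem exists_blocks {ε : ℤ → Bool} (hup : ∀ N b, ∃ n, N ≤ n ∧ ε n = b)
    (hdown : ∀ N b, ∃ n, n < N ∧ ε n = b) (s : Bool) :
    ∃ c : ℤ → ℤ, (∀ i, c i < c (i + 1)) ∧
      ∀ i j, c i ≤ j → j < c (i + 1) → ε j = side s i := by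
  classical
  let T := {n : ℤ // ε (n - 1) ≠ ε n}
  have hnext : ∀ N, ∃ t : T, N < t.1 := by
    intro N
    obtain ⟨m, ⟨hm, hm'⟩, hmin⟩ := Int.exists_least_of_bdd (P := fun n => N < n ∧ ε n = !ε N)
      ⟨N, fun z hz => hz.1.le⟩ (by
        obtain ⟨n, h1, h2⟩ := hup (N + 1) (!ε N)
        exact ⟨n, by omega, h2⟩)
    refine ⟨⟨m, fun h => ?_⟩, hm⟩
    rcases (show N ≤ m - 1 by omega).eq_or_lt with h1 | h1
    · rw [← h1, hm'] at h
      simp at h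
    · have := hmin (m - 1) ⟨h1, h.trans hm'⟩
      omega
  have hprev : ∀ N, ∃ t : T, t.1 < N := by
    intro N
    obtain ⟨k, hk, hk'⟩ := hdown N (!ε (N - 1))
    obtain ⟨m, ⟨hm, hm'⟩, hmax⟩ := Int.exists_greatest_of_bdd
      (P := fun n => n < N ∧ ε n = !ε (N - 1)) ⟨N, fun z hz => hz.1.le⟩ ⟨k, hk, hk'⟩
    have hne : m ≠ N - 1 := by
      rintro rfl
      simp at hm'
    refine ⟨⟨m + 1, fun h => ?_⟩, show m + 1 < N by omega⟩
    rw [add_sub_cancel_right] at h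
    have := hmax (m + 1) ⟨by omega, h.symm.trans hm'⟩
    omega
  have : NoMaxOrder T := ⟨fun t => hnext t.1⟩
  have : NoMinOrder T := ⟨fun t => hprev t.1⟩
  have : Nonempty T := ⟨(hnext 0).choose⟩
  let : LocallyFiniteOrder T := inferInstanceAs (LocallyFiniteOrder {n : ℤ // ε (n - 1) ≠ ε n})
  let : SuccOrder T := LinearLocallyFiniteOrder.succOrder T
  let : PredOrder T := LinearLocallyFiniteOrder.predOrder T
  let e : T ≃o ℤ := orderIsoIntOfLinearSuccPredArch
  let c : ℤ → ℤ := fun i => (e.symm i).1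
  have hc : ∀ i, c i < c (i + 1) := fun i => e.symm.strictMono (lt_add_one i)
  have hgap : ∀ i j, c i ≤ j → j < c (i + 1) → ε j = ε (c i) := by
    intro i j h1
    induction j, h1 using Int.leInduction with
    | base => exact fun _ => rfl
    | succ j hj ih =>
      intro h2
      rw [← ih (by omega)]
      by_contra hne
      let t : T := ⟨j + 1, by rw [add_sub_cancel_right]; exact fun h => hne h.symm⟩
      have h3 : i < e t := by
        rw [← e.symm_apply_lt]
        change c i < j + 1
        omega
      have h4 : e t < i + 1 := by
        rw [← e.lt_symm_apply]
        exact h2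
      omega
  have halt : ∀ i, ε (c (i + 1)) = !ε (c i) := by
    intro i
    have h1 : ε (c (i + 1) - 1) ≠ ε (c (i + 1)) := (e.symm (i + 1)).2
    rw [hgap i (c (i + 1) - 1) (by have := hc i; omega) (by omega)] at h1
    exact (Bool.eq_not_of_ne h1.symm)
  have hside : ∀ i, ε (c i) = side (ε (c 0)) i := by
    intro i
    induction i using Int.induction_on with
    | zero => rfl
    | succ n ih => rw [halt, ih, side_succ]
    | pred n ih =>
      have h1 := halt (-(n : ℤ) - 1)
      have h2 := side_succ (ε (c 0)) (-(n : ℤ) - 1)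
      rw [sub_add_cancel] at h1 h2
      rw [← Bool.not_inj_iff, ← h1, ← h2, ih]
  by_cases hs : ε (c 0) = s
  · exact ⟨c, hc, fun i j h1 h2 => by rw [hgap i j h1 h2, hside, hs]⟩
  · refine ⟨fun i => c (i + 1), fun i => hc _, fun i j h1 h2 => ?_⟩
    rw [hgap (i + 1) j h1 h2, hside, side_add]
    congr 1
    rw [← hside, ← zero_add (1 : ℤ), halt]
    exact (Bool.eq_not_of_ne (Ne.symm hs)).symm

/-! ### Coordinates adapted to an angle -/

theorem toPlane_add (u v : IntPoint) : toPlane (u + v) = toPlane u + toPlane v := by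
  funext i; simp [toPlane]

theorem toPlane_sub (u v : IntPoint) : toPlane (u - v) = toPlane u - toPlane v := by
  funext i; simp [toPlane]

theorem toPlane_neg (u : IntPoint) : toPlane (-u) = -toPlane u := by
  funext i; simp [toPlane]

theorem toPlane_smul (n : ℤ) (u : IntPoint) : toPlane (n • u) = (n : ℝ) • toPlane u := by
  funext i; simp [toPlane]

theorem toPlane_injective : Function.Injective toPlane := fun u v h => by
  funext i
  have := congrFun h i
  simpa [toPlane] using this

/-- An angle of the plane with no integer points on its sides, given by generators `p` and `q` of
its sides that are ordered and scaled so that `det (q, p) = 1`. -/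
structure AngleFrame where
  /-- The generator of the first side. -/
  p : Plane
  /-- The generator of the second side. -/
  q : Plane
  det_eq : q 0 * p 1 - q 1 * p 0 = 1
  /-- The coordinate along `p`. -/
  x : Plane →ₗ[ℝ] ℝ
  /-- The coordinate along `q`. -/
  y : Plane →ₗ[ℝ] ℝ
  x_eq : ∀ w, x w = q 0 * w 1 - q 1 * w 0
  y_eq : ∀ w, y w = w 0 * p 1 - w 1 * p 0
  x_ne : ∀ z : IntPoint, z ≠ 0 → x (toPlane z) ≠ 0
  y_ne : ∀ z : IntPoint, z ≠ 0 → y (toPlane z) ≠ 0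

namespace AngleFrame

variable (F : AngleFrame)

/-- The open angle with the sides `p` and `q`. -/
def angle : Set Plane := {w | 0 < F.x w ∧ 0 < F.y w}

theorem eq_smul_add (w : Plane) : w = F.x w • F.p + F.y w • F.q := by
  have h := F.det_eq
  funext i
  fin_cases i
  · simp only [F.x_eq, F.y_eq, Pi.add_apply, Pi.smul_apply, smul_eq_mul, Fin.zero_eta]
    linear_combination (-w 0) * h
  · simp only [F.x_eq, F.y_eq, Pi.add_apply, Pi.smul_apply, smul_eq_mul, Fin.mk_one]
    linear_combination (-w 1) * h

theorem ext_coords {w w' : Plane} (hx : F.x w = F.x w') (hy : F.y w = F.y w') : w = w' := by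
  rw [F.eq_smul_add w, F.eq_smul_add w', hx, hy]

theorem x_smul_add (s t : ℝ) : F.x (s • F.p + t • F.q) = s := by
  rw [F.x_eq]
  simp only [Pi.add_apply, Pi.smul_apply, smul_eq_mul]
  linear_combination s * F.det_eq

theorem y_smul_add (s t : ℝ) : F.y (s • F.p + t • F.q) = t := by
  rw [F.y_eq]
  simp only [Pi.add_apply, Pi.smul_apply, smul_eq_mul]
  linear_combination t * F.det_eq

theorem latDet_eq (u v : IntPoint) : (latDet u v : ℝ) =
    F.y (toPlane u) * F.x (toPlane v) - F.x (toPlane u) * F.y (toPlane v) := by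
  simp only [F.x_eq, F.y_eq, latDet, toPlane]
  push_cast
  linear_combination (-((u 0 : ℝ) * v 1 - u 1 * v 0)) * F.det_eq

theorem latDet_pos {u v : IntPoint} (hu : toPlane u ∈ F.angle) (hv : 0 < F.x (toPlane v))
    (hv' : F.y (toPlane v) < 0) : 0 < latDet u v := by
  have h := F.latDet_eq u v
  have h1 := mul_pos hu.2 hv
  have h2 := mul_neg_of_pos_of_neg hu.1 hv'
  exact_mod_cast (by linarith : (0 : ℝ) < latDet u v)

/-! ### The bases along the river -/

/-- A positively oriented basis `(u, v)` of the lattice, with `u` inside the angle and `v` inside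
the adjacent angle along the side `p`. -/
@[ext]
structure RiverBasis where
  /-- The vector inside the angle. -/
  u : IntPoint
  /-- The vector inside the adjacent angle. -/
  v : IntPoint
  det_eq : latDet u v = 1
  xu_pos : 0 < F.x (toPlane u)
  yu_pos : 0 < F.y (toPlane u)
  xv_pos : 0 < F.x (toPlane v)
  yv_neg : F.y (toPlane v) < 0

namespace RiverBasis

variable {F}
variable (X : F.RiverBasis)

theorem u_mem : toPlane X.u ∈ F.angle := ⟨X.xu_pos, X.yu_pos⟩

theorem y_add_ne : F.y (toPlane (X.u + X.v)) ≠ 0 := by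
  refine F.y_ne _ fun h => ?_
  have := X.det_eq
  rw [eq_neg_of_add_eq_zero_left h, latDet_neg_left, latDet_self] at this
  norm_num at this

theorem x_sub_ne : F.x (toPlane (X.u - X.v)) ≠ 0 := by
  refine F.x_ne _ fun h => ?_
  have := X.det_eq
  rw [sub_eq_zero.1 h, latDet_self] at this
  norm_num at this

/-- The turn at the head of the edge of the river between `u` and `v` is to the left. -/
noncomputable def isLeft : Bool := decide (F.y (toPlane (X.u + X.v)) < 0)

/-- The basis of the next edge of the river. -/
noncomputable def next : F.RiverBasis :=
  if h : F.y (toPlane (X.u + X.v)) < 0 then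
    { u := X.u
      v := X.u + X.v
      det_eq := by rw [latDet_add_right, latDet_self, zero_add, X.det_eq]
      xu_pos := X.xu_pos
      yu_pos := X.yu_pos
      xv_pos := by rw [toPlane_add, map_add]; exact add_pos X.xu_pos X.xv_pos
      yv_neg := h }
  else
    { u := X.u + X.v
      v := X.v
      det_eq := by rw [latDet_add_left, latDet_self, add_zero, X.det_eq]
      xu_pos := by rw [toPlane_add, map_add]; exact add_pos X.xu_pos X.xv_pos
      yu_pos := lt_of_le_of_ne (not_lt.1 h) X.y_add_ne.symm
      xv_pos := X.xv_pos
      yv_neg := X.yv_neg }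

/-- The basis of the preceding edge of the river. -/
noncomputable def prev : F.RiverBasis :=
  if h : F.x (toPlane (X.u - X.v)) < 0 then
    { u := X.u
      v := X.v - X.u
      det_eq := by rw [latDet_sub_right, latDet_self, sub_zero, X.det_eq]
      xu_pos := X.xu_pos
      yu_pos := X.yu_pos
      xv_pos := by rw [← neg_sub, toPlane_neg, map_neg]; linarith
      yv_neg := by rw [toPlane_sub, map_sub]; linarith [X.yv_neg, X.yu_pos] }
  else
    { u := X.u - X.v
      v := X.v
      det_eq := by rw [latDet_sub_left, latDet_self, sub_zero, X.det_eq]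
      xu_pos := lt_of_le_of_ne (not_lt.1 h) X.x_sub_ne.symm
      yu_pos := by rw [toPlane_sub, map_sub]; linarith [X.yv_neg, X.yu_pos]
      xv_pos := X.xv_pos
      yv_neg := X.yv_neg }

theorem next_of_isLeft (h : X.isLeft = true) : X.next.u = X.u ∧ X.next.v = X.u + X.v := by
  have h : F.y (toPlane (X.u + X.v)) < 0 := of_decide_eq_true h
  rw [next, dif_pos h]
  exact ⟨rfl, rfl⟩

theorem next_of_not_isLeft (h : X.isLeft = false) : X.next.u = X.u + X.v ∧ X.next.v = X.v := by
  have h : ¬ F.y (toPlane (X.u + X.v)) < 0 := of_decide_eq_false h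
  rw [next, dif_neg h]
  exact ⟨rfl, rfl⟩

theorem prev_cases : (X.prev.u = X.u ∧ X.prev.v = X.v - X.u) ∨
    (X.prev.u = X.u - X.v ∧ X.prev.v = X.v) := by
  unfold prev
  split_ifs
  · exact Or.inl ⟨rfl, rfl⟩
  · exact Or.inr ⟨rfl, rfl⟩

theorem prev_next : X.next.prev = X := by
  cases h : X.isLeft
  · obtain ⟨h1, h2⟩ := X.next_of_not_isLeft h
    have h3 : ¬ F.x (toPlane (X.next.u - X.next.v)) < 0 := by
      rw [h1, h2, add_sub_cancel_right]; exact X.xu_pos.not_gt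
    rw [prev, dif_neg h3]
    exact RiverBasis.ext (by simp [h1, h2]) h2
  · obtain ⟨h1, h2⟩ := X.next_of_isLeft h
    have h3 : F.x (toPlane (X.next.u - X.next.v)) < 0 := by
      rw [h1, h2, sub_add_cancel_left, toPlane_neg, map_neg]
      linarith [X.xv_pos]
    rw [prev, dif_pos h3]
    exact RiverBasis.ext h1 (by simp [h1, h2])

theorem next_prev : X.prev.next = X := by
  by_cases h : F.x (toPlane (X.u - X.v)) < 0
  · have hu : X.prev.u = X.u := by rw [prev, dif_pos h]
    have hv : X.prev.v = X.v - X.u := by rw [prev, dif_pos h]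
    obtain ⟨h1, h2⟩ := X.prev.next_of_isLeft (decide_eq_true (by
      rw [hu, hv, add_sub_cancel]; exact X.yv_neg))
    exact RiverBasis.ext (h1.trans hu) (by rw [h2, hu, hv, add_sub_cancel])
  · have hu : X.prev.u = X.u - X.v := by rw [prev, dif_neg h]
    have hv : X.prev.v = X.v := by rw [prev, dif_neg h]
    obtain ⟨h1, h2⟩ := X.prev.next_of_not_isLeft (decide_eq_false (by
      rw [hu, hv, sub_add_cancel]; exact X.yu_pos.not_gt))
    exact RiverBasis.ext (by rw [h1, hu, hv, sub_add_cancel]) (h2.trans hv)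

/-- One step along the river. -/
noncomputable def step : Equiv.Perm F.RiverBasis := ⟨next, prev, prev_next, next_prev⟩

/-- The basis `n` steps further along the river. -/
noncomputable def seq (n : ℤ) : F.RiverBasis := (step ^ n) X

theorem seq_zero : X.seq 0 = X := rfl

theorem seq_succ (n : ℤ) : X.seq (n + 1) = (X.seq n).next := by
  unfold seq
  rw [add_comm, zpow_add, zpow_one, Equiv.Perm.mul_apply]
  rfl

theorem seq_pred (n : ℤ) : X.seq (n - 1) = (X.seq n).prev := by
  have := X.seq_succ (n - 1)
  rw [sub_add_cancel] at this
  rw [this, prev_next]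

theorem seq_add (m n : ℤ) : X.seq (m + n) = (X.seq n).seq m := by
  unfold seq
  rw [zpow_add, Equiv.Perm.mul_apply]

theorem seq_succ_cases (n : ℤ) :
    ((X.seq n).isLeft = true ∧ (X.seq (n + 1)).u = (X.seq n).u ∧
      (X.seq (n + 1)).v = (X.seq n).u + (X.seq n).v) ∨
    ((X.seq n).isLeft = false ∧ (X.seq (n + 1)).u = (X.seq n).u + (X.seq n).v ∧
      (X.seq (n + 1)).v = (X.seq n).v) := by
  rw [seq_succ]
  cases h : (X.seq n).isLeft
  · exact Or.inr ⟨rfl, (X.seq n).next_of_not_isLeft h⟩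
  · exact Or.inl ⟨rfl, (X.seq n).next_of_isLeft h⟩

/-! ### All bases lie on a single river -/

theorem latDet_mul (a b c d : IntPoint) :
    latDet a b * latDet c d = latDet c b * latDet a d - latDet a c * latDet d b := by
  unfold latDet; ring

/-- If the coordinates of `X'` with respect to `X` are nonnegative, then `X'` is reached from `X`
by finitely many steps: going back from `X'` decreases the coordinates. -/
theorem exists_seq_eq_of_nonneg {X X' : F.RiverBasis} (h1 : 0 ≤ latDet X.u X'.u)
    (h2 : 0 ≤ latDet X'.v X.v) : ∃ n : ℤ, X.seq n = X' := by
  obtain ⟨N, hN⟩ : ∃ N : ℕ,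
      latDet X'.u X.v + latDet X.u X'.u + latDet X'.v X.v + latDet X.u X'.v ≤ N :=
    ⟨_, Int.self_le_toNat _⟩
  induction N using Nat.strong_induction_on generalizing X' with
  | _ N ih =>
  have hx := F.latDet_pos X'.u_mem X.xv_pos X.yv_neg
  have hw := F.latDet_pos X.u_mem X'.xv_pos X'.yv_neg
  have hdet := latDet_mul X.u X.v X'.u X'.v
  rw [X.det_eq, X'.det_eq, one_mul] at hdet
  by_cases hz : latDet X.u X'.u = 0 ∧ latDet X'.v X.v = 0
  · have h3 : latDet X'.u X.v * latDet X.u X'.v = 1 := by rw [hz.1] at hdet; linarith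
    have h4 : latDet X'.u X.v = 1 := by
      rcases Int.eq_one_or_neg_one_of_mul_eq_one h3 with h | h <;> omega
    have h5 : latDet X.u X'.v = 1 := by rw [h4] at h3; linarith
    refine ⟨0, RiverBasis.ext ?_ ?_⟩
    · simpa [seq_zero] using (coords_of_eq X.det_eq h4 hz.1).symm
    · simpa [seq_zero] using (coords_of_eq X.det_eq hz.2 h5).symm
  · suffices hs : ∃ n : ℤ, X.seq n = X'.prev by
      obtain ⟨n, hn⟩ := hs
      exact ⟨n + 1, by rw [seq_succ, hn, next_prev]⟩
    have hx' := F.latDet_pos X'.prev.u_mem X.xv_pos X.yv_neg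
    have hw' := F.latDet_pos X.u_mem X'.prev.xv_pos X'.prev.yv_neg
    have hdet' := latDet_mul X.u X.v X'.prev.u X'.prev.v
    rw [X.det_eq, X'.prev.det_eq, one_mul] at hdet'
    have hprod : 0 ≤ latDet X.u X'.prev.u * latDet X'.prev.v X.v := by
      have := mul_pos hx' hw'
      linarith
    -- One of the two off-diagonal coordinates is unchanged, and it controls the sign of the other.
    rcases X'.prev_cases with ⟨e1, e2⟩ | ⟨e1, e2⟩
    · have e3 : latDet X'.prev.v X.v = latDet X'.v X.v - latDet X'.u X.v := by
        rw [e2, latDet_sub_left]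
      have e4 : latDet X.u X'.prev.v = latDet X.u X'.v - latDet X.u X'.u := by
        rw [e2, latDet_sub_right]
      have h4 : 0 ≤ latDet X'.prev.v X.v := by
        rcases h1.eq_or_lt with h | h
        · have h5 : latDet X'.u X.v * latDet X.u X'.v = 1 := by rw [← h] at hdet; linarith
          have h6 : latDet X'.u X.v = 1 := by
            rcases Int.eq_one_or_neg_one_of_mul_eq_one h5 with h | h <;> omega
          omega
        · rw [e1] at hprod
          exact nonneg_of_mul_nonneg_right hprod h
      rw [e1] at hx'
      refine ih (N - 1) (by omega) (by rw [e1]; exact h1) h4 ?_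
      rw [e1, e3, e4]
      omega
    · have e3 : latDet X'.prev.u X.v = latDet X'.u X.v - latDet X'.v X.v := by
        rw [e1, latDet_sub_left]
      have e4 : latDet X.u X'.prev.u = latDet X.u X'.u - latDet X.u X'.v := by
        rw [e1, latDet_sub_right]
      have h4 : 0 ≤ latDet X.u X'.prev.u := by
        rcases h2.eq_or_lt with h | h
        · have h5 : latDet X'.u X.v * latDet X.u X'.v = 1 := by rw [← h] at hdet; linarith
          have h6 : latDet X'.u X.v = 1 := by
            rcases Int.eq_one_or_neg_one_of_mul_eq_one h5 with h | h <;> omega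
          have h7 : latDet X.u X'.v = 1 := by rw [h6] at h5; linarith
          omega
        · rw [e2] at hprod
          exact nonneg_of_mul_nonneg_left hprod h
      rw [e2] at hw'
      refine ih (N - 1) (by omega) h4 (by rw [e2]; exact h2) ?_
      rw [e2, e3, e4]
      omega

theorem exists_seq_eq (X X' : F.RiverBasis) : ∃ n : ℤ, X.seq n = X' := by
  have hx := F.latDet_pos X'.u_mem X.xv_pos X.yv_neg
  have hw := F.latDet_pos X.u_mem X'.xv_pos X'.yv_neg
  have hdet := latDet_mul X.u X.v X'.u X'.v
  rw [X.det_eq, X'.det_eq, one_mul] at hdet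
  have hprod : 0 ≤ latDet X.u X'.u * latDet X'.v X.v := by
    have := mul_pos hx hw
    linarith
  rcases mul_nonneg_iff.1 hprod with ⟨h1, h2⟩ | ⟨h1, h2⟩
  · exact exists_seq_eq_of_nonneg h1 h2
  · obtain ⟨n, hn⟩ := exists_seq_eq_of_nonneg (X := X') (X' := X)
      (by rw [latDet_swap]; omega) (by rw [latDet_swap]; omega)
    refine ⟨-n, ?_⟩
    rw [← hn, ← seq_add, neg_add_cancel, seq_zero]

end RiverBasis

end AngleFrame

namespace AngleFrame

variable (F : AngleFrame)

/-! ### Existence of a basis on the river -/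

/-- There are integer points with positive first coordinate and second coordinate of prescribed
sign. -/
theorem exists_intPoint {σ : ℝ} (hσ : σ = 1 ∨ σ = -1) :
    ∃ z : IntPoint, 0 < F.x (toPlane z) ∧ 0 < σ * F.y (toPlane z) := by
  obtain ⟨N, hN⟩ : ∃ N, N = |F.q 0| + |F.q 1| + |F.p 0| + |F.p 1| + 1 := ⟨_, rfl⟩
  -- Round a long vector inside the angle down to an integer vector.
  obtain ⟨w, hw⟩ : ∃ w, w = N • F.p + (σ * N) • F.q := ⟨_, rfl⟩
  have bound : ∀ i (c : ℝ), |c * Int.fract (w i)| ≤ |c| := fun i c => by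
    rw [abs_mul, abs_of_nonneg (Int.fract_nonneg (w i))]
    exact mul_le_of_le_one_right (abs_nonneg _) (Int.fract_lt_one _).le
  have hx : F.x w = N := by rw [hw, F.x_smul_add]
  have hy : F.y w = σ * N := by rw [hw, F.y_smul_add]
  have e : ∀ i, w i = (⌊w i⌋ : ℝ) + Int.fract (w i) := fun i => (Int.floor_add_fract _).symm
  refine ⟨fun i => ⌊w i⌋, ?_, ?_⟩
  · rw [F.x_eq, e 0, e 1] at hx
    rw [F.x_eq]
    simp only [toPlane]
    have h1 := le_abs_self (F.q 0 * Int.fract (w 1))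
    have h2 := neg_abs_le (F.q 1 * Int.fract (w 0))
    linarith [bound 1 (F.q 0), bound 0 (F.q 1), abs_nonneg (F.p 0), abs_nonneg (F.p 1)]
  · rw [F.y_eq, e 0, e 1] at hy
    rw [F.y_eq]
    simp only [toPlane]
    have h1 := abs_le.1 (bound 0 (F.p 1))
    have h2 := abs_le.1 (bound 1 (F.p 0))
    rcases hσ with rfl | rfl <;>
      linarith [abs_nonneg (F.q 0), abs_nonneg (F.q 1)]

/-- Pairs of integer vectors in the two adjacent angles are reduced to a basis: if the determinant
`d` is at least `2`, some integer point of the plane is not an integer combination of `u` and `v`;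
reduced modulo `u` and `v` it lies in one of the two angles, where it replaces one of the two
vectors and decreases the determinant. -/
theorem exists_riverBasis_of_latDet (d : ℕ) : ∀ u v : IntPoint, toPlane u ∈ F.angle →
    0 < F.x (toPlane v) → F.y (toPlane v) < 0 → latDet u v = d → Nonempty F.RiverBasis := by
  induction d using Nat.strong_induction_on with
  | _ d ih =>
  intro u v hu hv hv' hd
  have hdpos := F.latDet_pos hu hv hv'
  by_cases hone : latDet u v = 1
  · exact ⟨⟨u, v, hone, hu.1, hu.2, hv, hv'⟩⟩
  obtain ⟨z, hz⟩ : ∃ z : IntPoint, ¬ (latDet u v ∣ latDet z v ∧ latDet u v ∣ latDet u z) := by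
    by_contra! hall
    have h1 := hall ![1, 0]
    have h2 := hall ![0, 1]
    simp only [latDet, Matrix.cons_val_zero, Matrix.cons_val_one] at h1 h2 hone hdpos
    obtain ⟨⟨a, ha⟩, ⟨b, hb⟩⟩ := h1
    obtain ⟨⟨c, hc⟩, ⟨e, he⟩⟩ := h2
    obtain ⟨D, hD⟩ : ∃ D, D = u 0 * v 1 - u 1 * v 0 := ⟨_, rfl⟩
    rw [← hD] at ha hb hc he hone hdpos
    have : D * (D * (a * e - b * c)) = D * 1 := by
      linear_combination (-(D * e)) * ha - v 1 * he + D * c * hb - u 1 * hc - hD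
    have := mul_left_cancel₀ hdpos.ne' this
    rcases Int.eq_one_or_neg_one_of_mul_eq_one this with h | h <;> omega
  obtain ⟨w, hw⟩ : ∃ w, w = z - (latDet z v / latDet u v) • u - (latDet u z / latDet u v) • v :=
    ⟨_, rfl⟩
  have hX : latDet w v = latDet z v % latDet u v := by
    rw [hw, latDet_sub_left, latDet_sub_left, latDet_smul_left, latDet_smul_left, latDet_self,
      Int.emod_def]
    ring
  have hY : latDet u w = latDet u z % latDet u v := by
    rw [hw, latDet_sub_right, latDet_sub_right, latDet_smul_right, latDet_smul_right, latDet_self,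
      Int.emod_def]
    ring
  have hX0 : 0 ≤ latDet w v := by rw [hX]; exact Int.emod_nonneg _ hdpos.ne'
  have hY0 : 0 ≤ latDet u w := by rw [hY]; exact Int.emod_nonneg _ hdpos.ne'
  have hXd : latDet w v < latDet u v := by rw [hX]; exact Int.emod_lt_of_pos _ hdpos
  have hYd : latDet u w < latDet u v := by rw [hY]; exact Int.emod_lt_of_pos _ hdpos
  have hXY : 0 < latDet w v ∨ 0 < latDet u w := by
    by_contra! h
    exact hz ⟨Int.dvd_of_emod_eq_zero (by omega), Int.dvd_of_emod_eq_zero (by omega)⟩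
  have hxw : 0 < F.x (toPlane w) := by
    have h := congrArg (fun t => F.x (toPlane t)) (latDet_smul_eq u v w)
    simp only [toPlane_add, toPlane_smul, map_add, map_smul, smul_eq_mul] at h
    have h1 : (0 : ℝ) < latDet u v := by exact_mod_cast hdpos
    have h2 : (0 : ℝ) ≤ latDet w v := by exact_mod_cast hX0
    have h3 : (0 : ℝ) ≤ latDet u w := by exact_mod_cast hY0
    have h4 := hu.1
    have h5 : 0 < latDet w v * F.x (toPlane u) + latDet u w * F.x (toPlane v) := by
      rcases hXY with h | h
      · have : (0 : ℝ) < latDet w v := by exact_mod_cast h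
        positivity
      · have : (0 : ℝ) < latDet u w := by exact_mod_cast h
        positivity
    rw [← h] at h5
    exact pos_of_mul_pos_right h5 h1.le
  have hw0 : w ≠ 0 := by
    rintro rfl
    simp [latDet] at hXY
  rcases (F.y_ne w hw0).lt_or_gt with hy | hy
  · have := F.latDet_pos hu hxw hy
    exact ih (latDet u w).toNat (by omega) u w hu hxw hy (by omega)
  · have := F.latDet_pos (u := w) ⟨hxw, hy⟩ hv hv'
    exact ih (latDet w v).toNat (by omega) w v ⟨hxw, hy⟩ hv hv' (by omega)

theorem nonempty_riverBasis : Nonempty F.RiverBasis := by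
  obtain ⟨u, hu, hu'⟩ := F.exists_intPoint (Or.inl rfl)
  obtain ⟨v, hv, hv'⟩ := F.exists_intPoint (Or.inr rfl)
  have hu2 : toPlane u ∈ F.angle := ⟨hu, by linarith⟩
  have hv2 : F.y (toPlane v) < 0 := by linarith
  have := F.latDet_pos hu2 hv hv2
  exact F.exists_riverBasis_of_latDet (latDet u v).toNat u v hu2 hv hv2 (by omega)

namespace RiverBasis

variable {F}
variable (X : F.RiverBasis)

/-! ### The river as a path -/

/-- The vertex of the tree at the head of the `n`-th edge of the river. -/
noncomputable def path (n : ℤ) : Superbase :=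
  superbase (X.seq n).u (X.seq n).v (by rw [(X.seq n).det_eq]; exact isUnit_one)

theorem path_val (n : ℤ) : (X.path n).1 =
    {lax (X.seq n).u, lax (X.seq n).v, lax ((X.seq n).u + (X.seq n).v)} := rfl

theorem path_pred_val (n : ℤ) : (X.path (n - 1)).1 =
    {lax (X.seq n).u, lax (X.seq n).v, lax ((X.seq n).u - (X.seq n).v)} := by
  rw [path_val, seq_pred]
  rcases (X.seq n).prev_cases with ⟨h1, h2⟩ | ⟨h1, h2⟩
  · rw [h1, h2, lax_sub_comm, add_sub_cancel, Set.pair_comm]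
  · rw [h1, h2, sub_add_cancel, Set.pair_comm, Set.insert_comm, Set.pair_comm (lax _),
      Set.insert_comm]

theorem turn_path (n : ℤ) : Turn (X.seq n).isLeft (X.path (n - 1)) (X.path n) (X.path (n + 1)) := by
  rcases X.seq_succ_cases n with ⟨h, h1, h2⟩ | ⟨h, h1, h2⟩
  · rw [h]
    refine ⟨_, _, (X.seq n).det_eq, X.path_pred_val n, X.path_val n, ?_⟩
    rw [path_val, h1, h2]
  · rw [h]
    refine ⟨_, _, (X.seq n).det_eq, X.path_pred_val n, X.path_val n, ?_⟩
    rw [path_val, h1, h2, Set.insert_comm]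

/-- The largest first coordinate of a member of the `n`-th vertex of the river increases with
`n`. -/
theorem strictMono_x_add : StrictMono fun n => F.x (toPlane ((X.seq n).u + (X.seq n).v)) := by
  refine strictMono_int_of_lt_succ fun n => ?_
  have hu := (X.seq n).xu_pos
  have hv := (X.seq n).xv_pos
  rcases X.seq_succ_cases n with ⟨-, h1, h2⟩ | ⟨-, h1, h2⟩ <;>
  · simp only [h1, h2, toPlane_add, map_add]
    linarith

theorem abs_x_le_of_mem {z : IntPoint} {n : ℤ} (h : lax z ∈ (X.path n).1) :
    |F.x (toPlane z)| ≤ F.x (toPlane ((X.seq n).u + (X.seq n).v)) := by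
  have hu := (X.seq n).xu_pos
  have hv := (X.seq n).xv_pos
  simp only [path_val, Set.mem_insert_iff, Set.mem_singleton_iff, lax_eq_lax] at h
  rcases h with (rfl | rfl) | (rfl | rfl) | (rfl | rfl) <;>
    simp only [toPlane_neg, toPlane_add, map_neg, map_add, abs_neg] <;>
    rw [abs_of_pos (by linarith)] <;> linarith

theorem path_injective : Function.Injective X.path := by
  have hle : ∀ m n, X.path m = X.path n → m ≤ n := by
    intro m n h
    have h1 := X.abs_x_le_of_mem (z := (X.seq m).u + (X.seq m).v) (n := n)
      (by rw [← h, path_val]; simp)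
    exact X.strictMono_x_add.le_iff_le.1 ((le_abs_self _).trans h1)
  exact fun m n h => le_antisymm (hle m n h) (hle n m h.symm)

theorem isPath_path : IsPath X.path := by
  refine ⟨fun n => ⟨fun h => ?_, (X.seq (n + 1)).u, (X.seq (n + 1)).v, ?_, ?_⟩, X.path_injective⟩
  · have := X.path_injective h
    omega
  · exact isLatticeBasis_iff.2 (by rw [(X.seq (n + 1)).det_eq]; exact isUnit_one)
  · have h := X.path_pred_val (n + 1)
    rw [add_sub_cancel_right] at h
    rw [h, path_val]
    simp

end RiverBasis

/-- The form `Q` is a nonzero multiple of the product of the two coordinates. -/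
def Represents (Q : QuadraticForm ℝ Plane) : Prop :=
  ∃ c : ℝ, c ≠ 0 ∧ ∀ w, Q w = c * (F.x w * F.y w)

variable {F}

/-- Common members of `S` and `T` of different signs can be chosen inside the angle and inside the
adjacent angle. -/
theorem separates_iff {Q : QuadraticForm ℝ Plane} (hQ : F.Represents Q) {S T : Superbase} :
    Separates Q S T ↔ ∃ u v : IntPoint, lax u ∈ S.1 ∧ lax u ∈ T.1 ∧ lax v ∈ S.1 ∧ lax v ∈ T.1 ∧
      toPlane u ∈ F.angle ∧ 0 < F.x (toPlane v) ∧ F.y (toPlane v) < 0 := by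
  obtain ⟨c, hc, hQ⟩ := hQ
  have hval : ∀ z, laxValue Q (lax z) = c * (F.x (toPlane z) * F.y (toPlane z)) := fun z => hQ _
  constructor
  · rintro ⟨ℓ, m, h1, h2, h3, h4, h5, h6⟩
    induction ℓ using Quotient.inductionOn with | h a => ?_
    induction m using Quotient.inductionOn with | h b => ?_
    change lax a ∈ _ at h1 h2
    change lax b ∈ _ at h3 h4
    change 0 < laxValue Q (lax a) at h5
    change laxValue Q (lax b) < 0 at h6
    rw [hval] at h5 h6
    have hpos : ∀ z : IntPoint, 0 < F.x (toPlane z) * F.y (toPlane z) →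
        ∃ u, lax u = lax z ∧ toPlane u ∈ F.angle := by
      intro z hz
      rcases pos_and_pos_or_neg_and_neg_of_mul_pos hz with h | h
      · exact ⟨z, rfl, h⟩
      · exact ⟨-z, lax_neg z, by
          simp only [angle, Set.mem_ofPred_eq, toPlane_neg, map_neg]; constructor <;> linarith⟩
    have hneg : ∀ z : IntPoint, F.x (toPlane z) * F.y (toPlane z) < 0 →
        ∃ v, lax v = lax z ∧ 0 < F.x (toPlane v) ∧ F.y (toPlane v) < 0 := by
      intro z hz
      rcases mul_neg_iff.1 hz with h | h
      · exact ⟨z, rfl, h⟩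
      · refine ⟨-z, lax_neg z, ?_⟩
        simp only [toPlane_neg, map_neg]; constructor <;> linarith
    rcases hc.lt_or_gt with hc | hc
    · obtain ⟨v, ev, hv⟩ := hneg a (by
        by_contra! h; linarith [mul_nonpos_of_nonpos_of_nonneg hc.le h])
      obtain ⟨u, eu, hu⟩ := hpos b (by
        by_contra! h; linarith [mul_nonneg_of_nonpos_of_nonpos hc.le h])
      exact ⟨u, v, eu ▸ h3, eu ▸ h4, ev ▸ h1, ev ▸ h2, hu, hv⟩
    · obtain ⟨u, eu, hu⟩ := hpos a (pos_of_mul_pos_right h5 hc.le)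
      obtain ⟨v, ev, hv⟩ := hneg b (neg_of_mul_neg_right h6 hc.le)
      exact ⟨u, v, eu ▸ h1, eu ▸ h2, ev ▸ h3, ev ▸ h4, hu, hv⟩
  · rintro ⟨u, v, h1, h2, h3, h4, hu, hv, hv'⟩
    have h5 := mul_pos hu.1 hu.2
    have h6 := mul_neg_of_pos_of_neg hv hv'
    rcases hc.lt_or_gt with hc | hc
    · exact ⟨lax v, lax u, h3, h4, h1, h2, by rw [hval]; exact mul_pos_of_neg_of_neg hc h6,
        by rw [hval]; exact mul_neg_of_neg_of_pos hc h5⟩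
    · exact ⟨lax u, lax v, h1, h2, h3, h4, by rw [hval]; exact mul_pos hc h5,
        by rw [hval]; exact mul_neg_of_pos_of_neg hc h6⟩

theorem RiverBasis.isRiver_path (X : F.RiverBasis) {Q : QuadraticForm ℝ Plane}
    (hQ : F.Represents Q) : IsRiver Q X.path := by
  refine ⟨X.isPath_path, fun S T hST => ?_⟩
  rw [separates_iff hQ]
  constructor
  · rintro ⟨u, v, h1, h2, h3, h4, hu, hv, hv'⟩
    have hdet := F.latDet_pos hu hv hv'
    have hne : lax u ≠ lax v := by
      intro h
      rcases lax_eq_lax.1 h with rfl | rfl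
      · rw [latDet_self] at hdet; omega
      · rw [latDet_neg_left, latDet_self] at hdet; omega
    obtain ⟨hunit, hS⟩ := Superbase.eq_of_mem h1 h3 hne
    obtain ⟨-, hT⟩ := Superbase.eq_of_mem h2 h4 hne
    have hone : latDet u v = 1 := by rcases Int.isUnit_iff.1 hunit with h | h <;> omega
    obtain ⟨n, hn⟩ := exists_seq_eq X ⟨u, v, hone, hu.1, hu.2, hv, hv'⟩
    have e1 := X.path_val n
    have e2 := X.path_pred_val n
    rw [hn] at e1 e2
    refine ⟨n - 1, ?_⟩
    rw [sub_add_cancel]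
    rcases hS with hS | hS <;> rcases hT with hT | hT
    · exact absurd (Subtype.ext (hS.trans hT.symm)) hST.1
    · exact Or.inr ⟨Subtype.ext (e2.trans hT.symm), Subtype.ext (e1.trans hS.symm)⟩
    · exact Or.inl ⟨Subtype.ext (e2.trans hS.symm), Subtype.ext (e1.trans hT.symm)⟩
    · exact absurd (Subtype.ext (hS.trans hT.symm)) hST.1
  · rintro ⟨n, h⟩
    have e1 := X.path_val (n + 1)
    have e2 := X.path_pred_val (n + 1)
    rw [add_sub_cancel_right] at e2
    refine ⟨(X.seq (n + 1)).u, (X.seq (n + 1)).v, ?_⟩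
    have hm := And.intro (X.seq (n + 1)).u_mem
      (And.intro (X.seq (n + 1)).xv_pos (X.seq (n + 1)).yv_neg)
    rcases h with ⟨rfl, rfl⟩ | ⟨rfl, rfl⟩ <;> rw [e1, e2] <;> simpa using hm

end AngleFrame

/-- Two rivers of the same form differ by a shift and a change of direction. -/
theorem IsRiver.pathEquiv {Q : QuadraticForm ℝ Plane} {r r' : ℤ → Superbase} (h : IsRiver Q r)
    (h' : IsRiver Q r') : PathEquiv r r' := by
  have key : ∀ n, ∃ m, (r m = r' n ∧ r (m + 1) = r' (n + 1)) ∨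
      (r m = r' (n + 1) ∧ r (m + 1) = r' n) := fun n =>
    (h.2 _ _ (h'.1.1 n)).1 ((h'.2 _ _ (h'.1.1 n)).2 ⟨n, Or.inl ⟨rfl, rfl⟩⟩)
  have hex : ∀ n, ∃ m, r m = r' n := fun n => by
    obtain ⟨m, ⟨h1, -⟩ | ⟨-, h1⟩⟩ := key n
    · exact ⟨m, h1⟩
    · exact ⟨m + 1, h1⟩
  choose σ hσ using hex
  obtain ⟨k, hk⟩ := eq_shift_or_reflection (σ := σ)
    (fun m n e => h'.1.2 (by rw [← hσ, ← hσ, e]))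
    (fun n => by
      obtain ⟨m, ⟨h1, h2⟩ | ⟨h1, h2⟩⟩ := key n
      · rw [← hσ] at h1 h2
        have := h.1.2 h1
        have := h.1.2 h2
        omega
      · rw [← hσ] at h1 h2
        have := h.1.2 h1
        have := h.1.2 h2
        omega)
  refine ⟨1, k, ?_⟩
  simp only [one_smul]
  exact hk.imp (fun hk n => by rw [← hσ, hk]) (fun hk n => by rw [← hσ, hk])

namespace AngleFrame

namespace RiverBasis

variable {F : AngleFrame} (X : F.RiverBasis)

/-! ### The blocks of equal turns of the river -/

theorem seq_of_isLeft_false {m n : ℤ} (hmn : m ≤ n)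
    (h : ∀ j, m ≤ j → j < n → (X.seq j).isLeft = false) :
    (X.seq n).u = (X.seq m).u + (n - m) • (X.seq m).v ∧ (X.seq n).v = (X.seq m).v := by
  induction n, hmn using Int.leInduction with
  | base => simp
  | succ n hn ih =>
    obtain ⟨h1, h2⟩ := ih fun j hj hj' => h j hj (by omega)
    rcases X.seq_succ_cases n with ⟨h3, -⟩ | ⟨-, h4, h5⟩
    · rw [h n hn (by omega)] at h3
      exact absurd h3 (by simp)
    · refine ⟨?_, h5.trans h2⟩
      rw [h4, h1, h2, add_sub_right_comm, add_smul, one_smul, add_assoc]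

theorem seq_of_isLeft_true {m n : ℤ} (hmn : m ≤ n)
    (h : ∀ j, m ≤ j → j < n → (X.seq j).isLeft = true) :
    (X.seq n).u = (X.seq m).u ∧ (X.seq n).v = (X.seq m).v + (n - m) • (X.seq m).u := by
  induction n, hmn using Int.leInduction with
  | base => simp
  | succ n hn ih =>
    obtain ⟨h1, h2⟩ := ih fun j hj hj' => h j hj (by omega)
    rcases X.seq_succ_cases n with ⟨-, h4, h5⟩ | ⟨h3, -⟩
    · refine ⟨h4.trans h1, ?_⟩
      rw [h5, h1, h2, add_sub_right_comm, add_smul, one_smul]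
      abel
    · rw [h n hn (by omega)] at h3
      exact absurd h3 (by simp)

/-- The river does not turn to the same side forever: otherwise one of its vectors would be
translated again and again by the same vector, and would leave its angle. -/
theorem exists_isLeft_ge (N : ℤ) (b : Bool) : ∃ n, N ≤ n ∧ (X.seq n).isLeft = b := by
  by_contra! hall
  have hu := (X.seq N).yu_pos
  have hv := (X.seq N).yv_neg
  cases b
  · obtain ⟨k, hk⟩ := exists_nat_gt (-F.y (toPlane (X.seq N).v) / F.y (toPlane (X.seq N).u))
    rw [div_lt_iff₀ hu] at hk
    have h1 := (X.seq_of_isLeft_true (m := N) (n := N + k) (by omega)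
      (fun j hj _ => by simpa using hall j hj)).2
    have h2 := (X.seq (N + k)).yv_neg
    rw [h1, toPlane_add, toPlane_smul, map_add, map_smul, smul_eq_mul, add_sub_cancel_left,
      Int.cast_natCast] at h2
    linarith
  · obtain ⟨k, hk⟩ := exists_nat_gt (F.y (toPlane (X.seq N).u) / -F.y (toPlane (X.seq N).v))
    rw [div_lt_iff₀ (by linarith)] at hk
    have h1 := (X.seq_of_isLeft_false (m := N) (n := N + k) (by omega)
      (fun j hj _ => by simpa using hall j hj)).1
    have h2 := (X.seq (N + k)).yu_pos
    rw [h1, toPlane_add, toPlane_smul, map_add, map_smul, smul_eq_mul, add_sub_cancel_left,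
      Int.cast_natCast] at h2
    linarith

theorem exists_isLeft_lt (N : ℤ) (b : Bool) : ∃ n, n < N ∧ (X.seq n).isLeft = b := by
  by_contra! hall
  have hu := (X.seq N).xu_pos
  have hv := (X.seq N).xv_pos
  cases b
  · obtain ⟨k, hk⟩ := exists_nat_gt (F.x (toPlane (X.seq N).v) / F.x (toPlane (X.seq N).u))
    rw [div_lt_iff₀ hu] at hk
    obtain ⟨h0, h1⟩ := X.seq_of_isLeft_true (m := N - k) (n := N) (by omega)
      (fun j _ hj => by simpa using hall j hj)
    have h2 := (X.seq (N - k)).xv_pos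
    rw [h0, h1, toPlane_add, toPlane_smul, map_add, map_smul, smul_eq_mul, sub_sub_cancel,
      Int.cast_natCast] at hk
    linarith
  · obtain ⟨k, hk⟩ := exists_nat_gt (F.x (toPlane (X.seq N).u) / F.x (toPlane (X.seq N).v))
    rw [div_lt_iff₀ hv] at hk
    obtain ⟨h1, h0⟩ := X.seq_of_isLeft_false (m := N - k) (n := N) (by omega)
      (fun j _ hj => by simpa using hall j hj)
    have h2 := (X.seq (N - k)).xu_pos
    rw [h0, h1, toPlane_add, toPlane_smul, map_add, map_smul, smul_eq_mul, sub_sub_cancel,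
      Int.cast_natCast] at hk
    linarith

end RiverBasis

/-! ### The chain of vertices of the sail -/

/-- The data of the broken line that turns out to be the sail: its vertices `A k`, the primitive
direction `V k` of the edge from `A k` to `A (k + 1)`, and a sequence `a` whose terms of even index
are the integer lengths of the edges and whose terms of odd index are the integer sines of the
angles. -/
structure SailChain (F : AngleFrame) where
  /-- The vertices. -/
  A : ℤ → IntPoint
  /-- The primitive directions of the edges. -/
  V : ℤ → IntPoint
  /-- The integer lengths and sines. -/
  a : ℤ → ℕ
  a_pos : ∀ i, 0 < a i
  det_eq : ∀ k, latDet (A k) (V k) = 1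
  A_succ : ∀ k, A (k + 1) = A k + (a (2 * k) : ℤ) • V k
  V_eq : ∀ k, V k = V (k - 1) + (a (2 * k - 1) : ℤ) • A k
  A_mem : ∀ k, toPlane (A k) ∈ F.angle
  xV_pos : ∀ k, 0 < F.x (toPlane (V k))
  yV_neg : ∀ k, F.y (toPlane (V k)) < 0

/-- The vertices are the vectors `u` at the beginning of the blocks of right turns, and the lengths
and sines are the lengths of the blocks of right and of left turns. -/
theorem RiverBasis.exists_sailChain {F : AngleFrame} (X : F.RiverBasis) :
    ∃ K : F.SailChain, TurnsCoincide X.path K.a := by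
  obtain ⟨c, hc, hside⟩ := exists_blocks (ε := fun n => (X.seq n).isLeft) X.exists_isLeft_ge
    X.exists_isLeft_lt false
  have hright : ∀ k, (X.seq (c (2 * k + 1))).u = (X.seq (c (2 * k))).u +
      (c (2 * k + 1) - c (2 * k)) • (X.seq (c (2 * k))).v ∧
      (X.seq (c (2 * k + 1))).v = (X.seq (c (2 * k))).v := fun k =>
    X.seq_of_isLeft_false (hc _).le fun j h1 h2 => (hside _ j h1 h2).trans (by simp [side])
  have hleft : ∀ k, (X.seq (c (2 * k))).u = (X.seq (c (2 * k - 1))).u ∧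
      (X.seq (c (2 * k))).v = (X.seq (c (2 * k - 1))).v +
      (c (2 * k) - c (2 * k - 1)) • (X.seq (c (2 * k - 1))).u := fun k => by
    have h0 := hc (2 * k - 1)
    have h3 := hside (2 * k - 1)
    rw [sub_add_cancel] at h0 h3
    exact X.seq_of_isLeft_true h0.le fun j h1 h2 =>
      (h3 j h1 h2).trans (by simp [side])
  have hlen : ∀ i, ((c (i + 1) - c i).toNat : ℤ) = c (i + 1) - c i := fun i => by
    have := hc i
    omega
  refine ⟨{
    A := fun k => (X.seq (c (2 * k))).u
    V := fun k => (X.seq (c (2 * k))).v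
    a := fun i => (c (i + 1) - c i).toNat
    a_pos := fun i => by have := hc i; omega
    det_eq := fun k => (X.seq _).det_eq
    A_succ := fun k => ?_
    V_eq := fun k => ?_
    A_mem := fun k => (X.seq _).u_mem
    xV_pos := fun k => (X.seq _).xv_pos
    yV_neg := fun k => (X.seq _).yv_neg }, ?_⟩
  · rw [(hleft (k + 1)).1, show 2 * (k + 1) - 1 = 2 * k + 1 by ring, (hright k).1, hlen]
  · have h := (hright (k - 1)).2
    rw [show 2 * (k - 1) + 1 = 2 * k - 1 by ring] at h
    rw [← h, hlen, sub_add_cancel, (hleft k).1]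
    exact (hleft k).2
  · rw [turnsCoincide_iff]
    refine ⟨fun i => by have := hc i; simp only; omega, c, false, fun i => ?_, fun i j h1 h2 => ?_⟩
    · simp only
      rw [hlen]
      ring
    · rw [← hside i j h1 h2]
      exact X.turn_path j

end AngleFrame

/-! ### Integer lengths and sines along a chain -/

theorem integerLength_comm (P R : IntPoint) : integerLength P R = integerLength R P := by
  unfold integerLength
  rw [openSegment_symm]

theorem integerArea_comm (P R S : IntPoint) : integerArea P R S = integerArea S R P := by
  unfold integerArea
  have h : ∀ x y : IntPoint, AddSubgroup.closure {x, y} ≤ AddSubgroup.closure {-y, -x} := by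
    intro x y
    rw [AddSubgroup.closure_le]
    rintro z (rfl | rfl)
    · rw [← neg_neg z]
      exact neg_mem (AddSubgroup.subset_closure (by simp))
    · rw [← neg_neg z]
      exact neg_mem (AddSubgroup.subset_closure (by simp))
  congr 1
  apply le_antisymm
  · simpa using h (R - P) (S - R)
  · simpa using h (R - S) (P - R)

theorem integerSine_comm (P R S : IntPoint) : integerSine P R S = integerSine S R P := by
  unfold integerSine
  rw [integerArea_comm, integerLength_comm P R, integerLength_comm R S, mul_comm]

/-- The integer length of a multiple of a primitive vector. -/
theorem integerLength_add_smul {u v : IntPoint} (h : latDet u v = 1) (P : IntPoint) {n : ℕ}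
    (hn : 0 < n) : integerLength P (P + (n : ℤ) • v) = n := by
  have hn' : (0 : ℝ) < n := by exact_mod_cast hn
  have hset : {R : IntPoint | toPlane R ∈ openSegment ℝ (toPlane P) (toPlane (P + (n : ℤ) • v))} =
      ((Finset.Ioo (0 : ℤ) n).image fun j => P + j • v : Finset IntPoint) := by
    ext R
    simp only [Set.mem_ofPred_eq, openSegment_eq_image', Set.mem_image, Finset.coe_image,
      Finset.coe_Ioo, Set.mem_Ioo, toPlane_add, add_sub_cancel_left, toPlane_smul]
    constructor
    · rintro ⟨t, ⟨h0, h1⟩, ht⟩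
      have key : R - P = latDet u (R - P) • v ∧ (latDet u (R - P) : ℝ) = t * n := by
        have hi : ∀ i, ((R - P) i : ℝ) = t * n * v i := fun i => by
          have := congrFun ht i
          simp only [toPlane, Pi.add_apply, Pi.smul_apply, smul_eq_mul, Int.cast_natCast] at this
          push_cast [Pi.sub_apply]
          linarith
        have hd : (latDet u (R - P) : ℝ) = t * n := by
          have h' : ((latDet u v : ℤ) : ℝ) = 1 := by rw [h]; norm_num
          unfold latDet at h' ⊢
          push_cast at h' ⊢
          rw [hi 0, hi 1]
          linear_combination (t * n) * h'
        refine ⟨?_, hd⟩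
        funext i
        have := hi i
        rw [← hd] at this
        exact_mod_cast this
      refine ⟨latDet u (R - P), ⟨?_, ?_⟩, ?_⟩
      · have : (0 : ℝ) < latDet u (R - P) := by rw [key.2]; positivity
        exact_mod_cast this
      · have : (latDet u (R - P) : ℝ) < n := by rw [key.2]; nlinarith
        exact_mod_cast this
      · rw [← key.1, add_sub_cancel]
    · rintro ⟨j, ⟨h0, h1⟩, rfl⟩
      have h0' : (0 : ℝ) < j := by exact_mod_cast h0
      have h1' : (j : ℝ) < n := by exact_mod_cast h1
      refine ⟨j / n, ⟨by positivity, (div_lt_one hn').2 h1'⟩, ?_⟩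
      rw [toPlane_add, toPlane_smul, smul_smul, Int.cast_natCast, div_mul_cancel₀ _ hn'.ne']
  unfold integerLength
  rw [hset, Set.ncard_coe_finset, Finset.card_image_of_injective, Int.card_Ioo]
  · omega
  · intro i j hij
    have := congrArg (latDet u) hij
    simp only [latDet_add_right, latDet_smul_right, h] at this
    omega

namespace AngleFrame.SailChain

variable {F : AngleFrame} (K : F.SailChain)

theorem A_eq (k : ℤ) : K.A k = K.A (k - 1) + (K.a (2 * (k - 1)) : ℤ) • K.V (k - 1) := by
  have := K.A_succ (k - 1)
  rwa [sub_add_cancel] at this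

theorem latDet_A_V_pred (k : ℤ) : latDet (K.A k) (K.V (k - 1)) = 1 := by
  rw [A_eq, latDet_add_left, latDet_smul_left, latDet_self, mul_zero, add_zero, K.det_eq]

theorem integerLength_eq (k : ℤ) : integerLength (K.A k) (K.A (k + 1)) = K.a (2 * k) := by
  rw [K.A_succ]
  exact integerLength_add_smul (K.det_eq k) _ (K.a_pos _)

theorem integerSine_eq (k : ℤ) :
    integerSine (K.A (k - 1)) (K.A k) (K.A (k + 1)) = K.a (2 * k - 1) := by
  have h1 := K.integerLength_eq (k - 1)
  rw [sub_add_cancel] at h1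
  have ha := K.a_pos (2 * (k - 1))
  have hb := K.a_pos (2 * k)
  have hc := K.a_pos (2 * k - 1)
  have hdet : latDet (K.A k - K.A (k - 1)) (K.A (k + 1) - K.A k) =
      -((K.a (2 * k - 1) * (K.a (2 * (k - 1)) * K.a (2 * k)) : ℕ) : ℤ) := by
    rw [K.A_succ k, add_sub_cancel_left]
    nth_rewrite 1 [K.A_eq k]
    rw [add_sub_cancel_left, latDet_smul_left, latDet_smul_right, K.V_eq k, latDet_add_right,
      latDet_self, latDet_smul_right, latDet_swap (K.A k), K.latDet_A_V_pred]
    push_cast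
    ring
  have harea : integerArea (K.A (k - 1)) (K.A k) (K.A (k + 1)) =
      K.a (2 * k - 1) * (K.a (2 * (k - 1)) * K.a (2 * k)) := by
    unfold integerArea
    rw [index_closure_pair, hdet, Int.natAbs_neg, Int.natAbs_natCast]
    rw [hdet, neg_ne_zero]
    exact_mod_cast (by positivity : K.a (2 * k - 1) * (K.a (2 * (k - 1)) * K.a (2 * k)) ≠ 0)
  unfold integerSine
  rw [harea, h1, K.integerLength_eq]
  push_cast
  have ha' : (K.a (2 * (k - 1)) : ℚ) ≠ 0 := by positivity
  have hb' : (K.a (2 * k) : ℚ) ≠ 0 := by positivity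
  field_simp

end AngleFrame.SailChain

namespace AngleFrame

/-! ### The angle as a convex cone -/

theorem convex_angle (F : AngleFrame) : Convex ℝ F.angle :=
  (convex_halfSpace_gt F.x.isLinear 0).inter (convex_halfSpace_gt F.y.isLinear 0)

theorem isOpen_angle (F : AngleFrame) : IsOpen F.angle :=
  (isOpen_lt continuous_const F.x.continuous_of_finiteDimensional).inter
    (isOpen_lt continuous_const F.y.continuous_of_finiteDimensional)

theorem smul_mem_angle {F : AngleFrame} {w : Plane} (hw : w ∈ F.angle) {s : ℝ} (hs : 0 < s) :
    s • w ∈ F.angle := by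
  refine ⟨?_, ?_⟩ <;> rw [map_smul, smul_eq_mul]
  · exact mul_pos hs hw.1
  · exact mul_pos hs hw.2

namespace SailChain

variable {F : AngleFrame} (K : F.SailChain)

/-! ### The linear functionals of the edges of the sail -/

/-- The functional `det (·, V k)`. It is equal to `1` on the `k`-th edge of the sail, and at least
`1` on the convex hull of the integer points in the angle. -/
def level (k : ℤ) : Plane →ₗ[ℝ] ℝ :=
  F.x (toPlane (K.V k)) • F.y - F.y (toPlane (K.V k)) • F.x

/-- The functional `det (A k, ·)`. -/
def cross (k : ℤ) : Plane →ₗ[ℝ] ℝ :=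
  F.y (toPlane (K.A k)) • F.x - F.x (toPlane (K.A k)) • F.y

theorem level_apply (k : ℤ) (w : Plane) : K.level k w =
    F.x (toPlane (K.V k)) * F.y w - F.y (toPlane (K.V k)) * F.x w := rfl

theorem cross_apply (k : ℤ) (w : Plane) : K.cross k w =
    F.y (toPlane (K.A k)) * F.x w - F.x (toPlane (K.A k)) * F.y w := rfl

theorem level_toPlane (k : ℤ) (z : IntPoint) : K.level k (toPlane z) = latDet z (K.V k) := by
  rw [level_apply, F.latDet_eq]; ring

theorem det_eq_real (k : ℤ) : F.y (toPlane (K.A k)) * F.x (toPlane (K.V k)) -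
    F.x (toPlane (K.A k)) * F.y (toPlane (K.V k)) = 1 := by
  rw [← F.latDet_eq, K.det_eq, Int.cast_one]

/-- Cramer's rule in the basis `(A k, V k)`. -/
theorem eq_level_smul_add (k : ℤ) (w : Plane) :
    w = K.level k w • toPlane (K.A k) + K.cross k w • toPlane (K.V k) := by
  have h := K.det_eq_real k
  apply F.ext_coords <;>
    rw [map_add, map_smul, map_smul, smul_eq_mul, smul_eq_mul, level_apply, cross_apply]
  · linear_combination (-F.x w) * h
  · linear_combination (-F.y w) * h

theorem toPlane_A_succ (k : ℤ) :
    toPlane (K.A (k + 1)) = toPlane (K.A k) + (K.a (2 * k) : ℝ) • toPlane (K.V k) := by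
  rw [K.A_succ, toPlane_add, toPlane_smul, Int.cast_natCast]

theorem toPlane_V (k : ℤ) : toPlane (K.V k) =
    toPlane (K.V (k - 1)) + (K.a (2 * k - 1) : ℝ) • toPlane (K.A k) := by
  rw [K.V_eq, toPlane_add, toPlane_smul, Int.cast_natCast]

theorem a_pos_real (i : ℤ) : (0 : ℝ) < K.a i := by exact_mod_cast K.a_pos i

theorem level_A (k : ℤ) : K.level k (toPlane (K.A k)) = 1 := by
  rw [level_toPlane, K.det_eq, Int.cast_one]

theorem level_A_succ (k : ℤ) : K.level k (toPlane (K.A (k + 1))) = 1 := by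
  have := K.latDet_A_V_pred (k + 1)
  rw [add_sub_cancel_right] at this
  rw [level_toPlane, this, Int.cast_one]

theorem level_sub_level_pred (k : ℤ) (w : Plane) :
    K.level k w - K.level (k - 1) w = -(K.a (2 * k - 1) * K.cross k w) := by
  rw [level_apply, level_apply, cross_apply, K.toPlane_V k, map_add, map_add, map_smul, map_smul,
    smul_eq_mul, smul_eq_mul]
  ring

theorem cross_succ (k : ℤ) (w : Plane) :
    K.cross (k + 1) w = K.cross k w - K.a (2 * k) * K.level k w := by
  rw [level_apply, cross_apply, cross_apply, K.toPlane_A_succ k, map_add, map_add, map_smul,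
    map_smul, smul_eq_mul, smul_eq_mul]
  ring

/-! ### Growth of the vertices -/

theorem x_A_strictMono : StrictMono fun k => F.x (toPlane (K.A k)) := by
  refine strictMono_int_of_lt_succ fun k => ?_
  simp only [K.toPlane_A_succ, map_add, map_smul, smul_eq_mul]
  have := mul_pos (K.a_pos_real (2 * k)) (K.xV_pos k)
  linarith

theorem y_A_strictAnti : StrictAnti fun k => F.y (toPlane (K.A k)) := by
  refine strictAnti_int_of_succ_lt fun k => ?_
  simp only [K.toPlane_A_succ, map_add, map_smul, smul_eq_mul]
  have := mul_neg_of_pos_of_neg (K.a_pos_real (2 * k)) (K.yV_neg k)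
  linarith

theorem A_injective : Function.Injective K.A := fun j k h =>
  K.x_A_strictMono.injective (by simp only [h])

theorem x_V_strictMono : StrictMono fun k => F.x (toPlane (K.V k)) := by
  refine strictMono_int_of_lt_succ fun k => ?_
  have h := K.toPlane_V (k + 1)
  rw [add_sub_cancel_right] at h
  simp only [h, map_add, map_smul, smul_eq_mul]
  have := mul_pos (K.a_pos_real (2 * (k + 1) - 1)) (K.A_mem (k + 1)).1
  linarith

theorem y_V_strictMono : StrictMono fun k => F.y (toPlane (K.V k)) := by
  refine strictMono_int_of_lt_succ fun k => ?_
  have h := K.toPlane_V (k + 1)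
  rw [add_sub_cancel_right] at h
  simp only [h, map_add, map_smul, smul_eq_mul]
  have := mul_pos (K.a_pos_real (2 * (k + 1) - 1)) (K.A_mem (k + 1)).2
  linarith

theorem one_le_a_real (i : ℤ) : (1 : ℝ) ≤ K.a i := by exact_mod_cast K.a_pos i

theorem exists_lt_x_A (M : ℝ) : ∃ k, M < F.x (toPlane (K.A k)) := by
  have h0 := K.xV_pos 0
  have key : ∀ n : ℕ, n * F.x (toPlane (K.V 0)) ≤ F.x (toPlane (K.A n)) := by
    intro n
    induction n with
    | zero => simpa using (K.A_mem 0).1.le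
    | succ n ih =>
      push_cast
      rw [K.toPlane_A_succ, map_add, map_smul, smul_eq_mul]
      have h1 : F.x (toPlane (K.V 0)) ≤ F.x (toPlane (K.V n)) :=
        K.x_V_strictMono.monotone (by omega)
      have h2 := le_mul_of_one_le_left (h0.le.trans h1) (K.one_le_a_real (2 * n))
      linarith
  obtain ⟨n, hn⟩ := exists_nat_gt (M / F.x (toPlane (K.V 0)))
  exact ⟨n, ((div_lt_iff₀ h0).1 hn).trans_le (key n)⟩

theorem exists_lt_y_A (M : ℝ) : ∃ k, M < F.y (toPlane (K.A k)) := by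
  have h0 : 0 < -F.y (toPlane (K.V 0)) := by linarith [K.yV_neg 0]
  have key : ∀ n : ℕ, n * -F.y (toPlane (K.V 0)) ≤ F.y (toPlane (K.A (-n))) := by
    intro n
    induction n with
    | zero => simpa using (K.A_mem 0).2.le
    | succ n ih =>
      have h := K.toPlane_A_succ (-(n : ℤ) - 1)
      rw [sub_add_cancel] at h
      rw [h, map_add, map_smul, smul_eq_mul] at ih
      push_cast
      rw [neg_add, ← sub_eq_add_neg (-(n : ℤ))]
      have h1 : F.y (toPlane (K.V (-(n : ℤ) - 1))) ≤ F.y (toPlane (K.V 0)) :=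
        K.y_V_strictMono.monotone (by omega)
      have h2 := le_mul_of_one_le_left (h0.le.trans (neg_le_neg h1))
        (K.one_le_a_real (2 * (-(n : ℤ) - 1)))
      linarith
  obtain ⟨n, hn⟩ := exists_nat_gt (M / -F.y (toPlane (K.V 0)))
  exact ⟨-n, ((div_lt_iff₀ h0).1 hn).trans_le (key n)⟩

/-! ### The angle is the union of the cones over the edges -/

/-- The vertices tend to the directions of the two sides of the angle, so that every vector inside
the angle lies between two consecutive vertices. -/
theorem exists_cone {w : Plane} (hw : w ∈ F.angle) : ∃ (k : ℤ) (s t : ℝ), 0 ≤ s ∧ 0 ≤ t ∧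
    w = s • toPlane (K.A k) + t • toPlane (K.A (k + 1)) := by
  obtain ⟨hx, hy⟩ := hw
  have hanti : StrictAnti fun k => K.cross k w := by
    intro j k hjk
    simp only [cross_apply]
    have h1 := mul_lt_mul_of_pos_right (K.x_A_strictMono hjk) hy
    have h2 := mul_lt_mul_of_pos_right (K.y_A_strictAnti hjk) hx
    simp only at h1 h2
    linarith
  obtain ⟨k₁, hk₁⟩ : ∃ k, 0 ≤ K.cross k w := by
    obtain ⟨k, hk⟩ := K.exists_lt_y_A
      (max (F.y (toPlane (K.A 0))) (F.x (toPlane (K.A 0)) * F.y w / F.x w))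
    rw [max_lt_iff] at hk
    have h1 := mul_lt_mul_of_pos_right (K.x_A_strictMono (K.y_A_strictAnti.lt_iff_gt.1 hk.1)) hy
    have h2 := (div_lt_iff₀ hx).1 hk.2
    simp only at h1
    exact ⟨k, by rw [cross_apply]; linarith⟩
  obtain ⟨k₂, hk₂⟩ : ∃ k, K.cross k w < 0 := by
    obtain ⟨k, hk⟩ := K.exists_lt_x_A
      (max (F.x (toPlane (K.A 0))) (F.y (toPlane (K.A 0)) * F.x w / F.y w))
    rw [max_lt_iff] at hk
    have h1 := mul_lt_mul_of_pos_right (K.y_A_strictAnti (K.x_A_strictMono.lt_iff_lt.1 hk.1)) hx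
    have h2 := (div_lt_iff₀ hy).1 hk.2
    simp only at h1
    exact ⟨k, by rw [cross_apply]; linarith⟩
  obtain ⟨k, hk, hmax⟩ := Int.exists_greatest_of_bdd (P := fun k => 0 ≤ K.cross k w)
    ⟨k₂, fun z hz => (hanti.lt_iff_gt.1 (hk₂.trans_le hz)).le⟩ ⟨k₁, hk₁⟩
  have hk' : K.cross (k + 1) w < 0 := by
    by_contra! h
    have := hmax _ h
    omega
  have ha := K.a_pos_real (2 * k)
  refine ⟨k, K.level k w - K.cross k w / K.a (2 * k), K.cross k w / K.a (2 * k), ?_,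
    by positivity, ?_⟩
  · rw [K.cross_succ] at hk'
    rw [sub_nonneg, div_le_iff₀ ha]
    linarith
  · conv_lhs => rw [K.eq_level_smul_add k w]
    rw [K.toPlane_A_succ, smul_add, smul_smul, div_mul_cancel₀ _ ha.ne', sub_smul]
    abel

theorem level_smul_add_smul (k : ℤ) (s t : ℝ) :
    K.level k (s • toPlane (K.A k) + t • toPlane (K.A (k + 1))) = s + t := by
  rw [map_add, map_smul, map_smul, K.level_A, K.level_A_succ, smul_eq_mul, smul_eq_mul, mul_one,
    mul_one]

/-! ### The convex hull of the integer points in the angle -/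

theorem convex_hull : Convex ℝ (integerHull F.angle) := convex_convexHull ℝ _

theorem toPlane_mem_hull {z : IntPoint} (hz : toPlane z ∈ F.angle) :
    toPlane z ∈ integerHull F.angle := subset_convexHull ℝ _ ⟨hz, z, rfl⟩

theorem hull_subset_angle : integerHull F.angle ⊆ F.angle :=
  convexHull_min Set.inter_subset_left F.convex_angle

theorem one_le_level (k : ℤ) {w : Plane} (hw : w ∈ integerHull F.angle) : 1 ≤ K.level k w := by
  refine convexHull_min (t := {w | 1 ≤ K.level k w}) ?_
    (convex_halfSpace_ge (K.level k).isLinear 1) hw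
  rintro _ ⟨hz, z, rfl⟩
  change 1 ≤ K.level k (toPlane z)
  rw [level_toPlane]
  exact_mod_cast F.latDet_pos hz (K.xV_pos k) (K.yV_neg k)

theorem segment_subset_hull (k : ℤ) :
    segment ℝ (toPlane (K.A k)) (toPlane (K.A (k + 1))) ⊆ integerHull F.angle :=
  convex_hull.segment_subset (toPlane_mem_hull (K.A_mem k)) (toPlane_mem_hull (K.A_mem (k + 1)))

theorem level_of_mem_segment {k : ℤ} {w : Plane}
    (hw : w ∈ segment ℝ (toPlane (K.A k)) (toPlane (K.A (k + 1)))) : K.level k w = 1 := by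
  obtain ⟨s, t, -, -, hst, rfl⟩ := hw
  rw [level_smul_add_smul, hst]

/-- The integer points of the angle form a semigroup, so the hull absorbs their integer multiples,
hence by convexity their nonnegative real multiples. -/
theorem add_smul_mem_hull {y : Plane} (hy : y ∈ integerHull F.angle) {z : IntPoint}
    (hz : toPlane z ∈ F.angle) {t : ℝ} (ht : 0 ≤ t) :
    y + t • toPlane z ∈ integerHull F.angle := by
  obtain ⟨n, hn⟩ := exists_nat_gt t
  have hn0 : (0 : ℝ) < n := ht.trans_lt hn
  have h1 : y + (n : ℝ) • toPlane z ∈ integerHull F.angle := by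
    refine convexHull_min (t := (fun w => w + (n : ℝ) • toPlane z) ⁻¹' integerHull F.angle) ?_
      (convex_hull.translate_preimage_left _) hy
    rintro _ ⟨hw, w, rfl⟩
    refine subset_convexHull ℝ _ ⟨?_, w + (n : ℤ) • z, ?_⟩
    · have h := smul_mem_angle hz hn0
      exact ⟨by rw [map_add]; exact add_pos hw.1 h.1, by rw [map_add]; exact add_pos hw.2 h.2⟩
    · rw [toPlane_add, toPlane_smul, Int.cast_natCast]
  have h2 := convex_hull hy h1 (a := 1 - t / n) (b := t / n)
    (by rw [sub_nonneg, div_le_one hn0]; exact hn.le) (by positivity) (by ring)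
  convert! h2 using 1
  rw [smul_add, smul_smul, div_mul_cancel₀ _ hn0.ne', sub_smul, one_smul]
  abel

theorem add_mem_hull (K : F.SailChain) {y z : Plane} (hy : y ∈ integerHull F.angle)
    (hz : z ∈ F.angle) :
    y + z ∈ integerHull F.angle := by
  obtain ⟨k, s, t, hs, ht, rfl⟩ := K.exists_cone hz
  rw [← add_assoc]
  exact add_smul_mem_hull (add_smul_mem_hull hy (K.A_mem _) hs) (K.A_mem _) ht

/-- A vector of the angle on which all the functionals are at least `1` lies on an edge, or is the
sum of a point of the hull and of a positive multiple of itself. -/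
theorem mem_segment_or {w : Plane} (hw : w ∈ F.angle) (hlev : ∀ k, 1 ≤ K.level k w) :
    (∃ k, w ∈ segment ℝ (toPlane (K.A k)) (toPlane (K.A (k + 1)))) ∨
      ∃ y ∈ integerHull F.angle, ∃ c : ℝ, 0 < c ∧ w = y + c • w := by
  obtain ⟨k, s, t, hs, ht, hst⟩ := K.exists_cone hw
  have hl := hlev k
  have e : K.level k w = s + t := by rw [hst, level_smul_add_smul]
  rw [e] at hl
  rcases hl.eq_or_lt with h1 | h1
  · exact Or.inl ⟨k, s, t, hs, ht, h1.symm, hst.symm⟩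
  · have hpos : 0 < s + t := by linarith
    refine Or.inr ⟨(s + t)⁻¹ • w, K.segment_subset_hull k
      ⟨s / (s + t), t / (s + t), by positivity, by positivity, by field_simp, ?_⟩,
      1 - (s + t)⁻¹, by rw [sub_pos]; exact inv_lt_one_of_one_lt₀ h1, ?_⟩
    · rw [hst, smul_add, smul_smul, smul_smul, div_eq_inv_mul, div_eq_inv_mul]
    · rw [← add_smul, add_sub_cancel, one_smul]

theorem mem_interior_of_add (K : F.SailChain) {y z : Plane} (hy : y ∈ integerHull F.angle)
    (hz : z ∈ F.angle) :
    y + z ∈ interior (integerHull F.angle) := by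
  rw [mem_interior]
  refine ⟨(fun w => w - y) ⁻¹' F.angle, fun w hw => ?_,
    F.isOpen_angle.preimage (continuous_id.sub continuous_const), ?_⟩
  · have := K.add_mem_hull hy hw
    rwa [add_sub_cancel] at this
  · change y + z - y ∈ F.angle
    rwa [add_sub_cancel_left]

/-- The sides of the angle are asymptotes of the chain: no point on them is separated from the
origin by all the edges. -/
theorem mem_angle_of_mem_closure {w : Plane} (hw : w ∈ closure (integerHull F.angle)) :
    w ∈ F.angle ∧ ∀ k, 1 ≤ K.level k w := by
  have hx : 0 ≤ F.x w := closure_minimal (t := {w | 0 ≤ F.x w})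
    (fun z hz => (hull_subset_angle hz).1.le)
    (isClosed_le continuous_const F.x.continuous_of_finiteDimensional) hw
  have hy : 0 ≤ F.y w := closure_minimal (t := {w | 0 ≤ F.y w})
    (fun z hz => (hull_subset_angle hz).2.le)
    (isClosed_le continuous_const F.y.continuous_of_finiteDimensional) hw
  have hl : ∀ k, 1 ≤ K.level k w := fun k => closure_minimal (t := {w | 1 ≤ K.level k w})
    (fun z hz => K.one_le_level k hz)
    (isClosed_le continuous_const (K.level k).continuous_of_finiteDimensional) hw
  refine ⟨⟨lt_of_le_of_ne hx fun h => ?_, lt_of_le_of_ne hy fun h => ?_⟩, hl⟩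
  · obtain ⟨k, hk⟩ := K.exists_lt_y_A (F.y w)
    have h1 := hl k
    have h2 := K.det_eq_real k
    have h3 := mul_neg_of_pos_of_neg (K.A_mem k).1 (K.yV_neg k)
    have h4 := mul_lt_mul_of_pos_right hk (K.xV_pos k)
    rw [level_apply, ← h] at h1
    linarith
  · obtain ⟨k, hk⟩ := K.exists_lt_x_A (F.x w)
    have h1 := hl k
    have h2 := K.det_eq_real k
    have h3 := mul_pos (K.A_mem k).2 (K.xV_pos k)
    have h4 := mul_lt_mul_of_neg_right hk (K.yV_neg k)
    rw [level_apply, ← h] at h1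
    linarith

theorem sail_eq : sail F.angle =
    ⋃ k : ℤ, segment ℝ (toPlane (K.A k)) (toPlane (K.A (k + 1))) := by
  ext w
  rw [Set.mem_iUnion]
  constructor
  · rintro ⟨hcl, hint⟩
    obtain ⟨hw, hl⟩ := K.mem_angle_of_mem_closure hcl
    rcases K.mem_segment_or hw hl with h | ⟨y, hy, c, hc, e⟩
    · exact h
    · rw [e] at hint
      exact absurd (K.mem_interior_of_add hy (smul_mem_angle hw hc)) hint
  · rintro ⟨k, hk⟩
    have hmem := K.segment_subset_hull k hk
    refine ⟨subset_closure hmem, fun hint => ?_⟩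
    -- Near an interior point the functional of the edge would take values smaller than `1`.
    have hnhds := mem_interior_iff_mem_nhds.1 hint
    have hcont : Filter.Tendsto (fun ε : ℝ => (1 - ε) • w) (nhdsWithin 0 (Set.Ioi 0)) (nhds w) := by
      have : Continuous fun ε : ℝ => (1 - ε) • w := by fun_prop
      have h := this.tendsto 0
      rw [sub_zero, one_smul] at h
      exact h.mono_left nhdsWithin_le_nhds
    obtain ⟨ε, hε, hε0⟩ := ((hcont.eventually hnhds).and self_mem_nhdsWithin).exists
    have h1 := K.one_le_level k hε
    rw [map_smul, smul_eq_mul, K.level_of_mem_segment hk] at h1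
    have h2 : 0 < ε := hε0
    linarith

theorem eq_A_of_level_eq_one {k : ℤ} {w : Plane} (h : K.level k w = 1)
    (h' : K.level (k - 1) w = 1) : w = toPlane (K.A k) := by
  have h1 := K.level_sub_level_pred k w
  rw [h, h', sub_self, eq_comm, neg_eq_zero, mul_eq_zero] at h1
  rw [K.eq_level_smul_add k w, h, h1.resolve_left (K.a_pos_real _).ne', one_smul, zero_smul,
    add_zero]

theorem extremePoints_hull : (integerHull F.angle).extremePoints ℝ =
    Set.range fun k => toPlane (K.A k) := by
  ext w
  rw [mem_extremePoints_iff_left]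
  constructor
  · rintro ⟨hw, hext⟩
    rcases K.mem_segment_or (hull_subset_angle hw) (fun k => K.one_le_level k hw) with
      ⟨k, hk⟩ | ⟨y, hy, c, hc, e⟩
    · have hA := toPlane_mem_hull (K.A_mem k)
      have hA' := toPlane_mem_hull (K.A_mem (k + 1))
      by_contra hne
      have h1 : toPlane (K.A k) ≠ w := fun h => hne ⟨k, h⟩
      have h2 : toPlane (K.A (k + 1)) ≠ w := fun h => hne ⟨k + 1, h⟩
      exact h1 (hext _ hA _ hA' (mem_openSegment_of_ne_left_right h1 h2 hk))
    · -- The point `w` is the midpoint of `y` and `y + 2 c w`.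
      have hw' := hull_subset_angle hw
      have h1 := K.add_mem_hull hy (smul_mem_angle hw' (by linarith : 0 < 2 * c))
      have h2 := hext _ hy _ h1 ⟨1 / 2, 1 / 2, by norm_num, by norm_num, by norm_num, by
        conv_rhs => rw [e]
        rw [smul_add, smul_smul, ← add_assoc, ← add_smul, add_halves, one_smul, ← mul_assoc,
          one_div_mul_cancel two_ne_zero, one_mul]⟩
      rw [h2] at e
      have h3 := (smul_mem_angle hw' hc).1
      have h4 := congrArg F.x e
      rw [map_add] at h4
      linarith
  · rintro ⟨k, rfl⟩
    refine ⟨toPlane_mem_hull (K.A_mem k), fun w₁ h₁ w₂ h₂ hmem => ?_⟩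
    have key : ∀ j, K.level j (toPlane (K.A k)) = 1 → K.level j w₁ = 1 := by
      intro j hj
      obtain ⟨s, t, hs, ht, hst, e⟩ := hmem
      change _ = toPlane (K.A k) at e
      rw [← e, map_add, map_smul, map_smul, smul_eq_mul, smul_eq_mul] at hj
      have l1 := K.one_le_level j h₁
      have l2 := K.one_le_level j h₂
      nlinarith
    refine K.eq_A_of_level_eq_one (key k (K.level_A k)) (key (k - 1) ?_)
    have := K.level_A_succ (k - 1)
    rwa [sub_add_cancel] at this

theorem isVertexSequence : IsVertexSequence F.angle K.A :=
  ⟨K.A_injective, K.extremePoints_hull.symm, K.sail_eq⟩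

theorem isLLS : IsLLS F.angle K.a :=
  ⟨K.A, K.isVertexSequence, fun k => (K.integerLength_eq k).symm,
    fun k => (K.integerSine_eq k).symm⟩

/-! ### Uniqueness of the sequence of vertices -/

/-- The vertices on the line of an edge are the endpoints of the edge. -/
theorem eq_or_eq_of_level_eq_one {m j : ℤ} (h : K.level m (toPlane (K.A j)) = 1) :
    j = m ∨ j = m + 1 := by
  have hj := toPlane_mem_hull (K.A_mem j)
  have e := K.eq_level_smul_add m (toPlane (K.A j))
  rw [h, one_smul] at e
  have h1 : 0 ≤ K.cross m (toPlane (K.A j)) := by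
    have h2 := K.level_sub_level_pred m (toPlane (K.A j))
    have h3 := K.one_le_level (m - 1) hj
    rw [h] at h2
    exact nonneg_of_mul_nonneg_right (by linarith) (K.a_pos_real (2 * m - 1))
  have h4 : K.cross (m + 1) (toPlane (K.A j)) ≤ 0 := by
    have h2 := K.level_sub_level_pred (m + 1) (toPlane (K.A j))
    have h3 := K.one_le_level (m + 1) hj
    rw [add_sub_cancel_right, h] at h2
    by_contra! h5
    have := mul_pos (K.a_pos_real (2 * (m + 1) - 1)) h5
    linarith
  rw [K.cross_succ, h, mul_one] at h4
  have hx := congrArg F.x e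
  rw [map_add, map_smul, smul_eq_mul] at hx
  have hx' := congrArg F.x (K.toPlane_A_succ m)
  rw [map_add, map_smul, smul_eq_mul] at hx'
  have hv := K.xV_pos m
  have h5 : m ≤ j := K.x_A_strictMono.le_iff_le.1 (by
    have := mul_nonneg h1 hv.le; linarith)
  have h6 : j ≤ m + 1 := K.x_A_strictMono.le_iff_le.1 (by
    have := mul_le_mul_of_nonneg_right (sub_nonpos.1 h4) hv.le; linarith)
  omega

theorem exists_eq_comp {B : ℤ → IntPoint} (hB : IsVertexSequence F.angle B) :
    ∃ k, (∀ n, B n = K.A (n + k)) ∨ (∀ n, B n = K.A (k - n)) := by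
  have hex : ∀ n, ∃ m, K.A m = B n := by
    intro n
    have h : toPlane (B n) ∈ (integerHull F.angle).extremePoints ℝ := by
      rw [← hB.range_eq]
      exact ⟨n, rfl⟩
    rw [K.extremePoints_hull] at h
    obtain ⟨m, hm⟩ := h
    exact ⟨m, toPlane_injective hm⟩
  choose σ hσ using hex
  have hinj : Function.Injective σ := fun m n h => hB.injective (by rw [← hσ, ← hσ, h])
  obtain ⟨k, hk⟩ := eq_shift_or_reflection hinj fun n => by
    -- The midpoint of an edge of `B` lies on an edge of the chain, whose line contains both ends.
    have hmid : (1 / 2 : ℝ) • toPlane (B n) + (1 / 2 : ℝ) • toPlane (B (n + 1)) ∈ sail F.angle := by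
      rw [hB.sail_eq]
      exact Set.mem_iUnion.2 ⟨n, 1 / 2, 1 / 2, by norm_num, by norm_num, by norm_num, rfl⟩
    rw [K.sail_eq] at hmid
    obtain ⟨m, hm⟩ := Set.mem_iUnion.1 hmid
    have h1 := K.level_of_mem_segment hm
    rw [← hσ, ← hσ, map_add, map_smul, map_smul, smul_eq_mul, smul_eq_mul] at h1
    have h2 := K.one_le_level m (toPlane_mem_hull (K.A_mem (σ n)))
    have h3 := K.one_le_level m (toPlane_mem_hull (K.A_mem (σ (n + 1))))
    have h4 := K.eq_or_eq_of_level_eq_one (m := m) (j := σ n) (by linarith)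
    have h5 := K.eq_or_eq_of_level_eq_one (m := m) (j := σ (n + 1)) (by linarith)
    have h6 : σ (n + 1) ≠ σ n := fun h => by have := hinj h; omega
    omega
  refine ⟨k, hk.imp (fun hk n => ?_) (fun hk n => ?_)⟩ <;> rw [← hσ, hk]

theorem seqEquiv_of_isLLS {b : ℤ → ℕ} (hb : IsLLS F.angle b) : SeqEquiv K.a b := by
  obtain ⟨B, hB, hlen, hsin⟩ := hb
  obtain ⟨m, hm | hm⟩ := K.exists_eq_comp hB
  · refine ⟨2 * m, Or.inl fun i => ?_⟩
    obtain ⟨k, rfl | rfl⟩ : ∃ k, i = 2 * k ∨ i = 2 * k - 1 := ⟨(i + 1) / 2, by omega⟩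
    · rw [hlen, hm, hm, add_right_comm, K.integerLength_eq, mul_add]
    · have h := hsin k
      rw [hm, hm, hm, add_right_comm, sub_add_eq_add_sub, K.integerSine_eq] at h
      rw [show 2 * k - 1 + 2 * m = 2 * (k + m) - 1 by ring]
      exact_mod_cast h
  · refine ⟨2 * m - 2, Or.inr fun i => ?_⟩
    obtain ⟨k, rfl | rfl⟩ : ∃ k, i = 2 * k ∨ i = 2 * k - 1 := ⟨(i + 1) / 2, by omega⟩
    · have h := K.integerLength_eq (m - (k + 1))
      rw [integerLength_comm, show m - (k + 1) + 1 = m - k by ring] at h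
      rw [hlen, hm, hm, h]
      congr 1; ring
    · have h := hsin k
      rw [hm, hm, hm, integerSine_comm, show m - (k + 1) = m - k - 1 by ring,
        show m - (k - 1) = m - k + 1 by ring, K.integerSine_eq] at h
      rw [show 2 * m - 2 - (2 * k - 1) = 2 * (m - k) - 1 by ring]
      exact_mod_cast h

end SailChain

end AngleFrame

/-! ### Indefinite forms and their angles -/

section Form

variable {Q : QuadraticForm ℝ Plane}

theorem map_smul_add_smul (p q : Plane) (s t : ℝ) :
    Q (s • p + t • q) = s ^ 2 * Q p + t ^ 2 * Q q + s * t * QuadraticMap.polar Q p q := by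
  rw [QuadraticMap.map_add Q, QuadraticMap.map_smul, QuadraticMap.map_smul,
    QuadraticMap.polar_smul_left, QuadraticMap.polar_smul_right]
  simp only [smul_eq_mul]
  ring

theorem linearIndependent_pair_iff_det {p q : Plane} :
    LinearIndependent ℝ ![p, q] ↔ q 0 * p 1 - q 1 * p 0 ≠ 0 := by
  rw [LinearIndependent.pair_iff]
  constructor
  · intro h hdet
    have h0 := h (q 0) (-p 0) (by
      funext i
      fin_cases i <;> simp <;> linarith)
    have h1 := h (q 1) (-p 1) (by
      funext i
      fin_cases i <;> simp <;> linarith)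
    have := (h 1 0 (by
      funext i
      fin_cases i
      · simpa using h0.2
      · simpa using h1.2)).1
    norm_num at this
  · intro hdet s t hst
    have h0 : s * p 0 + t * q 0 = 0 := by simpa using congrFun hst 0
    have h1 : s * p 1 + t * q 1 = 0 := by simpa using congrFun hst 1
    constructor
    · refine (mul_eq_zero.1 (?_ : s * (q 0 * p 1 - q 1 * p 0) = 0)).resolve_right hdet
      linear_combination q 0 * h1 - q 1 * h0
    · refine (mul_eq_zero.1 (?_ : t * (q 0 * p 1 - q 1 * p 0) = 0)).resolve_right hdet
      linear_combination p 1 * h0 - p 0 * h1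

/-- Along the line through `v` with the direction `w`, where `Q v > 0 > Q w`, the form has two
zeros. -/
theorem exists_isAngle (hpos : ∃ v : Plane, 0 < Q v) (hneg : ∃ v : Plane, Q v < 0) :
    ∃ C, IsAngle Q C := by
  obtain ⟨v, hv⟩ := hpos
  obtain ⟨w, hw⟩ := hneg
  obtain ⟨b, hb⟩ : ∃ b, b = QuadraticMap.polar Q v w := ⟨_, rfl⟩
  obtain ⟨D, hD⟩ : ∃ D, D = b ^ 2 - 4 * Q v * Q w := ⟨_, rfl⟩
  have hDpos : 0 < D := by nlinarith [sq_nonneg b, mul_neg_of_pos_of_neg hv hw]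
  have hroot : ∀ r, r ^ 2 = D → Q ((2 * Q w) • v + (r - b) • w) = 0 := fun r hr => by
    rw [map_smul_add_smul, ← hb]
    linear_combination Q w * hr + Q w * hD
  have hind : w 0 * v 1 - w 1 * v 0 ≠ 0 := by
    rw [← linearIndependent_pair_iff_det, LinearIndependent.pair_iff]
    intro s t hst
    have h1 := map_smul_add_smul (Q := Q) v w s t
    have h2 : s • v = (-t) • w := by rw [neg_smul]; exact eq_neg_of_add_eq_zero_left hst
    have h3 := congrArg Q h2
    rw [QuadraticMap.map_smul, QuadraticMap.map_smul, smul_eq_mul, smul_eq_mul] at h3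
    have hs : s = 0 := by
      by_contra hs
      have := mul_pos (mul_self_pos.2 hs) hv
      have := mul_nonpos_of_nonneg_of_nonpos (mul_self_nonneg (-t)) hw.le
      linarith
    rw [hs, mul_zero, zero_mul, eq_comm, mul_eq_zero, mul_self_eq_zero, neg_eq_zero] at h3
    exact ⟨hs, h3.resolve_right hw.ne⟩
  refine ⟨_, (2 * Q w) • v + (√D - b) • w, (2 * Q w) • v + (-√D - b) • w,
    hroot _ (Real.sq_sqrt hDpos.le), hroot _ (by rw [neg_sq, Real.sq_sqrt hDpos.le]), ?_, rfl⟩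
  rw [linearIndependent_pair_iff_det]
  have h := mul_ne_zero (mul_ne_zero (by norm_num : (4 : ℝ) ≠ 0) (mul_ne_zero hw.ne
    (Real.sqrt_pos.2 hDpos).ne')) hind
  intro h0
  apply h
  simp only [Pi.add_apply, Pi.smul_apply, smul_eq_mul] at h0
  linear_combination (-1) * h0

/-- Adapted coordinates for an angle of the form: the generators of its sides are given in the
right order, and the first one is rescaled to make their determinant equal to `1`. -/
theorem exists_frame_of_det_pos (hpos : ∃ v : Plane, 0 < Q v)
    (hQ : ∀ z : IntPoint, Q (toPlane z) = 0 → z = 0) {p q : Plane} (hp : Q p = 0) (hq : Q q = 0)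
    (hdet : 0 < q 0 * p 1 - q 1 * p 0) :
    ∃ F : AngleFrame, F.Represents Q ∧
      F.angle = {w | ∃ s t : ℝ, 0 < s ∧ 0 < t ∧ w = s • p + t • q} := by
  obtain ⟨d, hd⟩ : ∃ d, d = q 0 * p 1 - q 1 * p 0 := ⟨_, rfl⟩
  rw [← hd] at hdet
  let x : Plane →ₗ[ℝ] ℝ := q 0 • LinearMap.proj 1 - q 1 • LinearMap.proj 0
  let y : Plane →ₗ[ℝ] ℝ := d⁻¹ • (p 1 • LinearMap.proj 0 - p 0 • LinearMap.proj 1)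
  have hx : ∀ w, x w = q 0 * w 1 - q 1 * w 0 := fun w => rfl
  have hy : ∀ w, y w = d⁻¹ * (p 1 * w 0 - p 0 * w 1) := fun w => rfl
  have hw : ∀ w, w = (x w * d⁻¹) • p + y w • q := fun w => by
    funext i
    rw [hx, hy]
    fin_cases i
    · simp only [Fin.zero_eta, Pi.add_apply, Pi.smul_apply, smul_eq_mul]
      field_simp
      rw [hd]; ring
    · simp only [Fin.mk_one, Pi.add_apply, Pi.smul_apply, smul_eq_mul]
      field_simp
      rw [hd]; ring
  obtain ⟨c, hc⟩ : ∃ c, c = d⁻¹ * QuadraticMap.polar Q p q := ⟨_, rfl⟩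
  have hval : ∀ w, Q w = c * (x w * y w) := fun w => by
    conv_lhs => rw [hw w, map_smul_add_smul, hp, hq]
    rw [hc]
    ring
  have hne : ∀ z : IntPoint, z ≠ 0 → x (toPlane z) * y (toPlane z) ≠ 0 := fun z hz h =>
    hz (hQ z (by rw [hval, h, mul_zero]))
  refine ⟨{
    p := d⁻¹ • p
    q := q
    det_eq := by
      simp only [Pi.smul_apply, smul_eq_mul]
      field_simp
      exact hd.symm
    x := x
    y := y
    x_eq := hx
    y_eq := fun w => by
      rw [hy]
      simp only [Pi.smul_apply, smul_eq_mul]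
      ring
    x_ne := fun z hz => left_ne_zero_of_mul (hne z hz)
    y_ne := fun z hz => right_ne_zero_of_mul (hne z hz) }, ⟨c, ?_, hval⟩, ?_⟩
  · rintro rfl
    obtain ⟨v, hv⟩ := hpos
    rw [hval, zero_mul] at hv
    exact lt_irrefl _ hv
  · ext w
    change 0 < x w ∧ 0 < y w ↔ _
    constructor
    · rintro ⟨h1, h2⟩
      exact ⟨x w * d⁻¹, y w, by positivity, h2, hw w⟩
    · rintro ⟨s, t, hs, ht, rfl⟩
      have h1 : x (s • p + t • q) = s * d := by
        rw [hx, hd]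
        simp only [Pi.add_apply, Pi.smul_apply, smul_eq_mul]
        ring
      have h2 : y (s • p + t • q) = t := by
        rw [hy]
        simp only [Pi.add_apply, Pi.smul_apply, smul_eq_mul]
        field_simp
        rw [hd]; ring
      rw [h1, h2]
      exact ⟨mul_pos hs hdet, ht⟩

theorem IsAngle.exists_frame (hpos : ∃ v : Plane, 0 < Q v)
    (hQ : ∀ z : IntPoint, Q (toPlane z) = 0 → z = 0) {C : Set Plane} (hC : IsAngle Q C) :
    ∃ F : AngleFrame, F.Represents Q ∧ F.angle = C := by
  obtain ⟨p, q, hp, hq, hind, rfl⟩ := hC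
  rcases (linearIndependent_pair_iff_det.1 hind).lt_or_gt with h | h
  · obtain ⟨F, hF, hangle⟩ := exists_frame_of_det_pos hpos hQ hq hp (by linarith)
    refine ⟨F, hF, hangle.trans ?_⟩
    ext w
    constructor <;>
    · rintro ⟨s, t, hs, ht, rfl⟩
      exact ⟨t, s, ht, hs, add_comm _ _⟩
  · exact exists_frame_of_det_pos hpos hQ hp hq h

end Form

/-! ### The LLS sequence and the turns of the river -/

theorem AngleFrame.exists_river_isLLS (F : AngleFrame) {Q : QuadraticForm ℝ Plane}
    (hF : F.Represents Q) : ∃ (r : ℤ → Superbase) (a : ℤ → ℕ), IsRiver Q r ∧ IsLLS F.angle a ∧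
      TurnsCoincide r a ∧ ∀ b, IsLLS F.angle b → SeqEquiv a b := by
  obtain ⟨X⟩ := F.nonempty_riverBasis
  obtain ⟨K, hK⟩ := X.exists_sailChain
  exact ⟨X.path, K.a, X.isRiver_path hF, K.isLLS, hK, fun b hb => K.seqEquiv_of_isLLS hb⟩

/-- Every LLS sequence of every angle of the form is the sequence of turns of every river. -/
theorem IsRiver.hasTurns {Q : QuadraticForm ℝ Plane} (hpos : ∃ v : Plane, 0 < Q v)
    (hQ : ∀ z : IntPoint, Q (toPlane z) = 0 → z = 0) {C : Set Plane} (hC : IsAngle Q C)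
    {a : ℤ → ℕ} (ha : IsLLS C a) {r : ℤ → Superbase} (hr : IsRiver Q r) : HasTurns r a := by
  obtain ⟨F, hF, rfl⟩ := hC.exists_frame hpos hQ
  obtain ⟨r₀, a₀, hr₀, -, h₀, huniq⟩ := F.exists_river_isLLS hF
  have h : HasTurns r₀ a₀ := Or.inl h₀
  exact (h.of_seqEquiv (huniq a ha)).of_pathEquiv (hr₀.pathEquiv hr)

end ConwaySail

theorem mainTheorem1 (Q : QuadraticForm ℝ Plane)
    (hpos : ∃ v : Plane, 0 < Q v) (hneg : ∃ v : Plane, Q v < 0)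
    (hQ : ∀ z : IntPoint, Q (toPlane z) = 0 → z = 0) :
    (∃ C, IsAngle Q C) ∧ (∃ r, IsRiver Q r) ∧
    ∀ C, IsAngle Q C → (∃ a, IsLLS C a) ∧
      ∀ a, IsLLS C a →
        -- the LLS sequence is the sequence of turns of the river, suitably directed
        (∀ r, IsRiver Q r → TurnsCoincide r a ∨ TurnsCoincide (reversePath r) a) ∧
        -- a path with this sequence of turns is the river, up to `PGL(2, ℤ)` and direction
        (∀ r, IsRiver Q r → ∀ p, IsPath p →
          ((TurnsCoincide p a ∨ TurnsCoincide (reversePath p) a) ↔ PathEquiv r p)) ∧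
        -- forms with the same LLS sequence have the same river, up to `PGL(2, ℤ)` and direction
        (∀ Q' : QuadraticForm ℝ Plane,
          (∃ v : Plane, 0 < Q' v) → (∃ v : Plane, Q' v < 0) →
          (∀ z : IntPoint, Q' (toPlane z) = 0 → z = 0) →
          ∀ C', IsAngle Q' C' → ∀ a', IsLLS C' a' → SeqEquiv a a' →
          ∀ r, IsRiver Q r → ∀ r', IsRiver Q' r' → PathEquiv r r') := by
  obtain ⟨C₀, hC₀⟩ := exists_isAngle hpos hneg
  refine ⟨⟨C₀, hC₀⟩, ?_, fun C hC => ⟨?_, fun a ha => ⟨fun r hr => hr.hasTurns hpos hQ hC ha,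
    fun r hr p _ => ?_, fun Q' hpos' _ hQ' C' hC' a' ha' haa' r hr r' hr' => ?_⟩⟩⟩
  · obtain ⟨F, hF, -⟩ := hC₀.exists_frame hpos hQ
    obtain ⟨r, -, hr, -⟩ := F.exists_river_isLLS hF
    exact ⟨r, hr⟩
  · obtain ⟨F, hF, rfl⟩ := hC.exists_frame hpos hQ
    obtain ⟨-, a, -, ha, -⟩ := F.exists_river_isLLS hF
    exact ⟨a, ha⟩
  · have h := hr.hasTurns hpos hQ hC ha
    exact ⟨fun hp => h.pathEquiv hp, fun hp => h.of_pathEquiv hp⟩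
  · have h := hr.hasTurns hpos hQ hC ha
    have h' := hr'.hasTurns hpos' hQ' hC' ha'
    exact h.pathEquiv (h'.of_seqEquiv haa'.symm)
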